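/- Let $\mathcal G$ be a connected abelian Lie group of dimension $N\ge 1$ with Lie algebra $\mathfrak g$, and let $B$ be a connected oriented smooth surface. Let $\pi:M\to B$ be a twisted principal $\mathcal G$-bundle, i.e. a smooth fiber bundle with fiber $\mathcal G$ and structure group $\mathcal G\rtimes \operatorname{Aut}(\mathcal G)_\delta$, where $\operatorname{Aut}(\mathcal G)_\delta$ is the automorphism group with the discrete topology and $(s,a)$ acts on $\mathcal G$ by $x\mapsto s+a(x)$. The locally constant automorphism parts of the transition functions, acting on $\mathfrak g$ by their differentials, define a flat vector bundle $e\to B$ with fiber $\mathfrak g\cong\mathbb R^N$. Assume that $e$ has holonomy in $\det^{-1}(\pm1)\subset \operatorname{GL}(N,\mathbb R)$, and accordingly use local trivializations of $M$ for which the transition functions of $e$ have determinant $\pm 1$. Let $\overline g$ be a smooth Riemannian metric on $M$ for which the free local $\mathcal G$-actions are isometric. In adapted local coordinates (coordinates $b^\alpha$ on $B$ and linear coordinates $x^I$ on the fibers, given by a local trivialization and a fixed basis of $\mathfrak g$) write $$\overline g=\sum_{I,J=1}^N G_{IJ}\,(dx^I+A^I)(dx^J+A^J)+\sum_{\alpha,\beta=1}^2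 g_{\alpha\beta}\,db^\alpha db^\beta ,$$ where $G_{IJ}$, $A^I=A^I_\alpha db^\alpha$ and $g_{\alpha\beta}$ depend only on the point of $B$; put $F^I_{\alpha\beta}=\partial_\alpha A^I_\beta-\partial_\beta A^I_\alpha$, and let $\operatorname{dvol}_B$ be the area form of the metric $g_B=(g_{\alpha\beta})$ on the oriented surface $B$. The mixed Ricci equation is the equation $\operatorname{Ric}_{\overline g}(V,X)=0$ for all vertical vectors $V$ and all horizontal ($\overline g$-orthogonal to the fibers) vectors $X$ at the same point of $M$; at a point where $A=0$ it says that the components $\overline R_{I\alpha}$ vanish. (1) The mixed Ricci equation holds on $M$ if and only if $\sqrt{\det G}\;G_{IJ}\,\dfrac{F^J}{\operatorname{dvol}_B}$ defines a flat section of the dual bundle $e^*$. (2) Suppose that $\overline g$ is Einstein, $\operatorname{Ric}_{\overline g}=\lambda\overline g$ for some $\lambda\in\mathbb R$. Then the mixed Ricci equation holds. If moreover, for some basepoint $b_0\in B$, the monodromy representation $\rho$ of $\pi_1(B,b_0)$ on the fiber of $e^*$ over $b_0$ does not have a trivial one-dimensional subrepresentation, then $F=0$. -/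

import Mathlib

open scoped Manifold ContDiff Topology

/-! ### Metrics and Ricci curvature in local coordinates

Coordinates are labelled by an arbitrary finite type `κ`, so that the coordinate space is `κ → ℝ`. -/

section Coordinates

variable {κ : Type*} [Fintype κ] [DecidableEq κ]

/-- The partial derivative `∂_k f` at `z`. -/
noncomputable def pd (k : κ) (f : (κ → ℝ) → ℝ) (z : κ → ℝ) : ℝ :=
  fderiv ℝ f z (Pi.single k 1)

/-- The Christoffel symbol `Γ^k_{ij}` of a metric `h_{ij}` given in local coordinates. -/
noncomputable def christoffel (h : (κ → ℝ) → Matrix κ κ ℝ) (k i j : κ) (z : κ → ℝ) : ℝ :=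
  (1 / 2) * ∑ l, (h z)⁻¹ k l *
    (pd i (fun w => h w j l) z + pd j (fun w => h w i l) z - pd l (fun w => h w i j) z)

/-- The component `R_{ij} = ∂_k Γ^k_{ij} - ∂_j Γ^k_{ik} + Γ^k_{kl} Γ^l_{ij} - Γ^k_{jl} Γ^l_{ik}`
of the Ricci tensor of a metric `h_{ij}` given in local coordinates. -/
noncomputable def ricci (h : (κ → ℝ) → Matrix κ κ ℝ) (i j : κ) (z : κ → ℝ) : ℝ :=
  (∑ k, pd k (christoffel h k i j) z) - (∑ k, pd j (christoffel h k i k) z)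
    + (∑ k, ∑ l, christoffel h k k l z * christoffel h l i j z)
    - ∑ k, ∑ l, christoffel h k j l z * christoffel h l i k z

end Coordinates

section Manifold

variable {m : ℕ} {M : Type*} [TopologicalSpace M] [ChartedSpace (EuclideanSpace ℝ (Fin m)) M]
  [IsManifold (𝓡 m) ∞ M]

variable (m M) in
/-- Smooth Riemannian metrics on the `m`-dimensional manifold `M`. -/
abbrev SmoothMetric : Type _ :=
  Bundle.ContMDiffRiemannianMetric (𝓡 m) ∞ (EuclideanSpace ℝ (Fin m))
    (fun p : M => TangentSpace (𝓡 m) p)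

variable {κ : Type*} [Fintype κ] [DecidableEq κ]

/-- The components of the Riemannian metric `gbar` in the coordinates given by the local
parametrization `ψ` of `M`: `h_{kl} = gbar(∂_k ψ, ∂_l ψ)`. -/
noncomputable def coordMetric (gbar : SmoothMetric m M) (ψ : (κ → ℝ) → M) (z : κ → ℝ) :
    Matrix κ κ ℝ :=
  Matrix.of fun k l => gbar.inner (ψ z) (mfderiv 𝓘(ℝ, κ → ℝ) (𝓡 m) ψ z (Pi.single k 1 : κ → ℝ))
    (mfderiv 𝓘(ℝ, κ → ℝ) (𝓡 m) ψ z (Pi.single l 1 : κ → ℝ))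

/-- `Ric(gbar) = lam • gbar` on `M`: the equation holds in all smooth local coordinates, that is,
for every smooth `ψ` from an open set `Ω` of `ℝ^m` to `M` with invertible differentials. -/
def IsEinstein (gbar : SmoothMetric m M) (lam : ℝ) : Prop :=
  ∀ (κ : Type) [Fintype κ] [DecidableEq κ], Fintype.card κ = m →
    ∀ (Ω : Set (κ → ℝ)) (ψ : (κ → ℝ) → M), IsOpen Ω →
      ContMDiffOn 𝓘(ℝ, κ → ℝ) (𝓡 m) ∞ ψ Ω →
      (∀ z ∈ Ω, Function.Bijective (mfderiv 𝓘(ℝ, κ → ℝ) (𝓡 m) ψ z)) →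
      ∀ z ∈ Ω, ∀ k l : κ,
        ricci (coordMetric gbar ψ) k l z = lam * coordMetric gbar ψ z k l

variable (m M) in
/-- An orientation of `M`, given by an oriented atlas: a set of smooth charts that cover `M` and
whose coordinate changes have positive Jacobian determinant. -/
structure OrientedAtlas where
  /-- the positively oriented charts -/
  charts : Set (OpenPartialHomeomorph M (EuclideanSpace ℝ (Fin m)))
  subset_maximalAtlas : charts ⊆ IsManifold.maximalAtlas (𝓡 m) ∞ M
  exists_mem_source : ∀ b : M, ∃ β ∈ charts, b ∈ β.source
  det_pos : ∀ β ∈ charts, ∀ β' ∈ charts, ∀ y ∈ (β.symm.trans β').source,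
    0 < (fderiv ℝ (β' ∘ β.symm) y).det

end Manifold

/-! ### Twisted principal bundles -/

/-- A twisted principal `𝒢`-bundle `proj : M → B` over an `n`-dimensional manifold, for an
`N`-dimensional abelian Lie group `𝒢` (written additively): a smooth fiber bundle with fiber `𝒢`
and structure group `𝒢 ⋊ Aut(𝒢)_δ`, where `Aut(𝒢)_δ` is the automorphism group with the discrete
topology and `(s, a)` acts on `𝒢` by `x ↦ s + a x`. -/
structure TwistedBundle (ι : Type*) (n N : ℕ) (B 𝒢 M : Type*)
    [TopologicalSpace B] [ChartedSpace (EuclideanSpace ℝ (Fin n)) B]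
    [AddCommGroup 𝒢] [TopologicalSpace 𝒢] [ChartedSpace (EuclideanSpace ℝ (Fin N)) 𝒢]
    [TopologicalSpace M] [ChartedSpace (EuclideanSpace ℝ (Fin (n + N))) M] where
  /-- the bundle projection -/
  proj : M → B
  /-- the local trivializations -/
  triv : ι → Bundle.Trivialization 𝒢 proj
  exists_mem_baseSet : ∀ b : B, ∃ i, b ∈ (triv i).baseSet
  contMDiffOn_triv : ∀ i, ContMDiffOn (𝓡 (n + N)) ((𝓡 n).prod (𝓡 N)) ∞ (triv i) (triv i).source
  contMDiffOn_triv_symm : ∀ i, ContMDiffOn ((𝓡 n).prod (𝓡 N)) (𝓡 (n + N)) ∞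
    (triv i).toOpenPartialHomeomorph.symm (triv i).target
  /-- the translation part of the coordinate changes -/
  shift : ι → ι → B → 𝒢
  contMDiffOn_shift : ∀ i j, ContMDiffOn (𝓡 n) (𝓡 N) ∞ (shift i j)
    ((triv i).baseSet ∩ (triv j).baseSet)
  /-- the automorphism part of the coordinate changes -/
  aut : ι → ι → B → (𝒢 ≃+ 𝒢)
  contMDiff_aut : ∀ i j b, b ∈ (triv i).baseSet ∩ (triv j).baseSet →
    ContMDiff (𝓡 N) (𝓡 N) ∞ (aut i j b) ∧ ContMDiff (𝓡 N) (𝓡 N) ∞ (aut i j b).symm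
  aut_locallyConstant : ∀ i j b, b ∈ (triv i).baseSet ∩ (triv j).baseSet →
    ∀ᶠ b' in 𝓝 b, aut i j b' = aut i j b
  transition : ∀ i j b, b ∈ (triv i).baseSet ∩ (triv j).baseSet → ∀ x : 𝒢,
    (triv j).toOpenPartialHomeomorph.symm (b, x)
      = (triv i).toOpenPartialHomeomorph.symm (b, shift i j b + aut i j b x)

namespace TwistedBundle

variable {ι : Type*} {n N : ℕ} {B 𝒢 M : Type*}
  [TopologicalSpace B] [ChartedSpace (EuclideanSpace ℝ (Fin n)) B]
  [AddCommGroup 𝒢] [TopologicalSpace 𝒢] [ChartedSpace (EuclideanSpace ℝ (Fin N)) 𝒢]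
  [TopologicalSpace M] [ChartedSpace (EuclideanSpace ℝ (Fin (n + N))) M]

/-! #### The flat vector bundles `e` and `e*`

The Lie algebra of `𝒢` is the tangent space at `0`, which is `ℝ^N`. The flat vector bundle `e` has
fiber this Lie algebra and the differentials of the automorphisms `aut i j b` as its locally
constant transition functions. -/

/-- The transition function of `e` from the trivialization `j` to the trivialization `i`. -/
noncomputable def linAut (P : TwistedBundle ι n N B 𝒢 M) (i j : ι) (b : B) :
    EuclideanSpace ℝ (Fin N) →L[ℝ] EuclideanSpace ℝ (Fin N) :=
  mfderiv (𝓡 N) (𝓡 N) (P.aut i j b) (0 : 𝒢)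

/-- The structure group of the flat vector bundle `e` is `det⁻¹(± 1)`. -/
def HasDetOne (P : TwistedBundle ι n N B 𝒢 M) : Prop :=
  ∀ i j b, b ∈ (P.triv i).baseSet ∩ (P.triv j).baseSet → |(P.linAut i j b).det| = 1

/-- A flat section of `e*`, written in the local trivializations: `σ i b` is the value at `b` in
the trivialization `i`; these values match on overlaps and are locally constant. -/
structure IsFlatSection (P : TwistedBundle ι n N B 𝒢 M)
    (σ : ι → B → Module.Dual ℝ (EuclideanSpace ℝ (Fin N))) : Prop where
  compatible : ∀ i j b, b ∈ (P.triv i).baseSet ∩ (P.triv j).baseSet →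
    σ j b = σ i b ∘ₗ (P.linAut i j b : EuclideanSpace ℝ (Fin N) →ₗ[ℝ] EuclideanSpace ℝ (Fin N))
  locallyConstant : ∀ i, ∀ b ∈ (P.triv i).baseSet, ∀ᶠ b' in 𝓝 b, σ i b' = σ i b

/-- A parallel section of `e*` along the path `γ`, written in the local trivializations. -/
structure IsParallelAlong (P : TwistedBundle ι n N B 𝒢 M) {b₀ b₁ : B} (γ : Path b₀ b₁)
    (σ : ι → unitInterval → Module.Dual ℝ (EuclideanSpace ℝ (Fin N))) : Prop where
  compatible : ∀ i j t, γ t ∈ (P.triv i).baseSet ∩ (P.triv j).baseSet →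
    σ j t = σ i t ∘ₗ
      (P.linAut i j (γ t) : EuclideanSpace ℝ (Fin N) →ₗ[ℝ] EuclideanSpace ℝ (Fin N))
  locallyConstant : ∀ i t, γ t ∈ (P.triv i).baseSet → ∀ᶠ s in 𝓝 t, σ i s = σ i t

/-- Identify the fiber of `e*` over `b₀` with the dual of `ℝ^N` by the trivialization `i`. The
monodromy of `e*` along the loop `γ` at `b₀` maps `v` to `w`. -/
def Monodromy (P : TwistedBundle ι n N B 𝒢 M) (i : ι) {b₀ : B} (γ : Path b₀ b₀)
    (v w : Module.Dual ℝ (EuclideanSpace ℝ (Fin N))) : Prop :=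
  ∃ σ : ι → unitInterval → Module.Dual ℝ (EuclideanSpace ℝ (Fin N)),
    P.IsParallelAlong γ σ ∧ σ i 0 = v ∧ σ i 1 = w

/-- The monodromy representation of `e*` at the basepoint `b₀` (whose fiber is identified with the
dual of `ℝ^N` by the trivialization `i`) has a trivial one-dimensional subrepresentation: there is
a line on which the monodromy along every loop is the identity. -/
def HasTrivialLine (P : TwistedBundle ι n N B 𝒢 M) (i : ι) (b₀ : B) : Prop :=
  ∃ W : Submodule ℝ (Module.Dual ℝ (EuclideanSpace ℝ (Fin N))), Module.finrank ℝ W = 1 ∧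
    ∀ γ : Path b₀ b₀, ∀ v ∈ W, P.Monodromy i γ v v

/-! #### Invariant metrics and adapted coordinates -/

variable [IsManifold (𝓡 (n + N)) ∞ M]

/-- The action of `x : 𝒢` on the part of `M` over the domain of the trivialization `i`. -/
noncomputable def act (P : TwistedBundle ι n N B 𝒢 M) (i : ι) (x : 𝒢) (p : M) : M :=
  (P.triv i).toOpenPartialHomeomorph.symm ((P.triv i p).1, (P.triv i p).2 + x)

/-- The free local `𝒢`-actions on `M` are isometric. -/
def IsInvariant (P : TwistedBundle ι n N B 𝒢 M) (gbar : SmoothMetric (n + N) M) : Prop :=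
  ∀ (i : ι) (x : 𝒢), ∀ p ∈ (P.triv i).source, ∀ u v : TangentSpace (𝓡 (n + N)) p,
    gbar.inner (P.act i x p) (mfderiv (𝓡 (n + N)) (𝓡 (n + N)) (P.act i x) p u)
      (mfderiv (𝓡 (n + N)) (𝓡 (n + N)) (P.act i x) p v) = gbar.inner p u v

/-- Adapted local coordinates `(b^α, x^I)` on `M`: a trivialization, coordinates on the base, and
linear coordinates on the group. The latter are given by the homomorphism `lin : ℝ^N → 𝒢` whose
differential at `0` is the identity, that is, by the exponential map of `𝒢`. -/
structure AdaptedCoords [IsManifold (𝓡 n) ∞ B] (P : TwistedBundle ι n N B 𝒢 M) where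
  /-- the trivialization -/
  idx : ι
  /-- the chart of the base -/
  chart : OpenPartialHomeomorph B (EuclideanSpace ℝ (Fin n))
  chart_mem : chart ∈ IsManifold.maximalAtlas (𝓡 n) ∞ B
  /-- the linear coordinates on the group -/
  lin : EuclideanSpace ℝ (Fin N) →+ 𝒢
  contMDiff_lin : ContMDiff (𝓡 N) (𝓡 N) ∞ lin
  mfderiv_lin : ∀ v : EuclideanSpace ℝ (Fin N), mfderiv (𝓡 N) (𝓡 N) lin 0 v = v

namespace AdaptedCoords

variable [IsManifold (𝓡 n) ∞ B] {P : TwistedBundle ι n N B 𝒢 M}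

/-- The point of `B` with coordinates `y`. -/
noncomputable def point (C : P.AdaptedCoords) (y : Fin n → ℝ) : B :=
  C.chart.symm (WithLp.toLp 2 y)

/-- The coordinates of the points of the base that are covered by the adapted coordinates. -/
def domain (C : P.AdaptedCoords) : Set (Fin n → ℝ) :=
  {y | WithLp.toLp 2 y ∈ C.chart.target ∧ C.point y ∈ (P.triv C.idx).baseSet}

/-- The local parametrization `(b^α, x^I) ↦ M`. -/
noncomputable def param (C : P.AdaptedCoords) (z : Fin n ⊕ Fin N → ℝ) : M :=
  (P.triv C.idx).toOpenPartialHomeomorph.symm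
    (C.point (fun α => z (Sum.inl α)), C.lin (WithLp.toLp 2 fun I => z (Sum.inr I)))

/-- The components of the metric on `M` in the adapted coordinates at the point `(y, 0)`; by
invariance they do not change along the fiber. -/
noncomputable def metric (C : P.AdaptedCoords) (gbar : SmoothMetric (n + N) M)
    (y : Fin n → ℝ) : Matrix (Fin n ⊕ Fin N) (Fin n ⊕ Fin N) ℝ :=
  coordMetric gbar C.param (Sum.elim y 0)

/-! The functions `G_{IJ}`, `A^I_α` and `g_{αβ}` in
`gbar = G_{IJ} (dx^I + A^I) (dx^J + A^J) + g_{αβ} db^α db^β`. -/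

/-- The inner product `G_{IJ}` on `e`. -/
noncomputable def G (C : P.AdaptedCoords) (gbar : SmoothMetric (n + N) M) (y : Fin n → ℝ) :
    Matrix (Fin N) (Fin N) ℝ :=
  (C.metric gbar y).toBlocks₂₂

/-- The connection `A^I_α`; it is determined by `gbar_{Iα} = G_{IJ} A^J_α`. -/
noncomputable def A (C : P.AdaptedCoords) (gbar : SmoothMetric (n + N) M) (y : Fin n → ℝ) :
    Matrix (Fin N) (Fin n) ℝ :=
  (C.G gbar y)⁻¹ * (C.metric gbar y).toBlocks₂₁

/-- The metric `g_{αβ}` on `B`; it is determined by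
`gbar_{αβ} = g_{αβ} + G_{IJ} A^I_α A^J_β`. -/
noncomputable def g (C : P.AdaptedCoords) (gbar : SmoothMetric (n + N) M) (y : Fin n → ℝ) :
    Matrix (Fin n) (Fin n) ℝ :=
  (C.metric gbar y).toBlocks₁₁ - (C.A gbar y).transpose * C.G gbar y * C.A gbar y

/-- The curvature `F^I_{αβ} = ∂_α A^I_β - ∂_β A^I_α`. -/
noncomputable def F (C : P.AdaptedCoords) (gbar : SmoothMetric (n + N) M) (I : Fin N)
    (α β : Fin n) (y : Fin n → ℝ) : ℝ :=
  pd α (fun w => C.A gbar w I β) y - pd β (fun w => C.A gbar w I α) y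

end AdaptedCoords

/-- The curvature `F` vanishes. -/
def CurvatureVanishes [IsManifold (𝓡 n) ∞ B] (P : TwistedBundle ι n N B 𝒢 M)
    (gbar : SmoothMetric (n + N) M) : Prop :=
  ∀ C : P.AdaptedCoords, ∀ y ∈ C.domain, ∀ I α β, C.F gbar I α β y = 0

/-- The mixed Ricci equation: in adapted coordinates, `Ric(∂_I, X_α) = 0`, where
`X_α = ∂_α - A^J_α ∂_J` is the horizontal lift of `∂_α`. At points where `A = 0` this says that
the component `R_{Iα}` vanishes. -/
def MixedRicciEquation [IsManifold (𝓡 n) ∞ B] (P : TwistedBundle ι n N B 𝒢 M)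
    (gbar : SmoothMetric (n + N) M) : Prop :=
  ∀ C : P.AdaptedCoords, ∀ y ∈ C.domain, ∀ (x : Fin N → ℝ) (I : Fin N) (α : Fin n),
    ricci (coordMetric gbar C.param) (Sum.inr I) (Sum.inl α) (Sum.elim y x)
      - ∑ J, C.A gbar y J α *
          ricci (coordMetric gbar C.param) (Sum.inr I) (Sum.inr J) (Sum.elim y x) = 0

end TwistedBundle

/-! ### The conserved quantity over an oriented two-dimensional base -/

namespace TwistedBundle

variable {ι : Type*} {N : ℕ} {B 𝒢 M : Type*}
  [TopologicalSpace B] [ChartedSpace (EuclideanSpace ℝ (Fin 2)) B] [IsManifold (𝓡 2) ∞ B]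
  [AddCommGroup 𝒢] [TopologicalSpace 𝒢] [ChartedSpace (EuclideanSpace ℝ (Fin N)) 𝒢]
  [TopologicalSpace M] [ChartedSpace (EuclideanSpace ℝ (Fin (2 + N))) M]
  [IsManifold (𝓡 (2 + N)) ∞ M]

/-- The components `√(det G) G_{IJ} F^J / dvol_B` in positively oriented adapted coordinates, in
which `dvol_B = √(det g) db¹ ∧ db²` and `F^J = F^J_{12} db¹ ∧ db²`. -/
noncomputable def AdaptedCoords.twist {P : TwistedBundle ι 2 N B 𝒢 M} (C : P.AdaptedCoords)
    (gbar : SmoothMetric (2 + N) M) (I : Fin N) (y : Fin 2 → ℝ) : ℝ :=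
  √(C.G gbar y).det * ∑ J, C.G gbar y I J * (C.F gbar J 0 1 y / √(C.g gbar y).det)

/-- `√(det G) G_{IJ} F^J / dvol_B` defines a flat section of `e*`. -/
def TwistIsFlat (P : TwistedBundle ι 2 N B 𝒢 M) (o : OrientedAtlas 2 B)
    (gbar : SmoothMetric (2 + N) M) : Prop :=
  ∃ σ : ι → B → Module.Dual ℝ (EuclideanSpace ℝ (Fin N)), P.IsFlatSection σ ∧
    ∀ C : P.AdaptedCoords, C.chart ∈ o.charts → ∀ y ∈ C.domain, ∀ I,
      σ C.idx (C.point y) (EuclideanSpace.single I 1) = C.twist gbar I y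

end TwistedBundle

/-!
Kaluza-Klein reduction. In adapted coordinates translated to an arbitrary point of the fibre, the
vertical fields `∂_I` are Killing fields, and the Ricci tensor in the direction of a Killing field
is a divergence: up to a factor, the mixed components are `∂_γ (√det g √det G G_{IJ} F^{J,γβ})`.
Over a surface `F^J` is a multiple of the area form, so this is the derivative of the function
`√det G G_{IJ} F^J / dvol`, rotated by a quarter turn. A change of adapted coordinates acts on these
functions by the transition functions of `e*`, because determinants `±1` leave `√det G` invariant
and orientation preserving charts have positive Jacobian; so the mixed Ricci equation says that
they form a flat section. A nonzero flat section spans a trivial line of the monodromy; in its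
absence the section vanishes, and with it `F`, since `G` is invertible.
-/

/-! ### Calculus of partial derivatives -/

section PartialDerivatives

variable {κ : Type*} [DecidableEq κ] {f f' : (κ → ℝ) → ℝ} {z : κ → ℝ}

lemma pd_const (k : κ) (c : ℝ) (z : κ → ℝ) : pd k (fun _ => c) z = 0 := by
  simp only [pd, fderiv_fun_const, Pi.zero_apply, zero_apply]

lemma pd_congr (h : f =ᶠ[𝓝 z] f') (k : κ) : pd k f z = pd k f' z := by
  simp only [pd, h.fderiv_eq]

section Finite

variable [Finite κ]

lemma pd_add (k : κ) (hf : DifferentiableAt ℝ f z) (hf' : DifferentiableAt ℝ f' z) :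
    pd k (fun w => f w + f' w) z = pd k f z + pd k f' z := by
  cases nonempty_fintype κ
  rw [pd, fderiv_fun_add hf hf', add_apply, pd, pd]

lemma pd_mul (k : κ) (hf : DifferentiableAt ℝ f z) (hf' : DifferentiableAt ℝ f' z) :
    pd k (fun w => f w * f' w) z = pd k f z * f' z + f z * pd k f' z := by
  cases nonempty_fintype κ
  simp only [pd, fderiv_fun_mul hf hf', add_apply, smul_apply, smul_eq_mul]
  ring

lemma pd_const_mul (k : κ) (c : ℝ) (hf : DifferentiableAt ℝ f z) :
    pd k (fun w => c * f w) z = c * pd k f z := by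
  rw [pd_mul k (differentiableAt_const c) hf, pd_const, zero_mul, zero_add]

lemma pd_sum {ι : Type*} {s : Finset ι} {f : ι → (κ → ℝ) → ℝ} (k : κ)
    (hf : ∀ i ∈ s, DifferentiableAt ℝ (f i) z) :
    pd k (fun w => ∑ i ∈ s, f i w) z = ∑ i ∈ s, pd k (f i) z := by
  cases nonempty_fintype κ
  simp only [pd, fderiv_fun_sum hf, sum_apply]

lemma pd_eq_zero_of_invariant {k : κ} (hf : ∀ t : ℝ, f (z + t • Pi.single k 1) = f z) :
    pd k f z = 0 := by
  cases nonempty_fintype κ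
  by_cases hd : DifferentiableAt ℝ f z
  · simp only [pd, ← hd.lineDeriv_eq_fderiv, lineDeriv, hf, deriv_const]
  · simp only [pd, fderiv_zero_of_not_differentiableAt hd, zero_apply]

lemma pd_add_right {v : κ → ℝ} (hf : ∀ w, f (w + v) = f w) (k : κ) (w : κ → ℝ) :
    pd k f (w + v) = pd k f w := by
  cases nonempty_fintype κ
  rw [pd, ← fderiv_comp_add_right, funext hf, pd]

end Finite

variable [Fintype κ]

lemma fderiv_apply_eq_sum_pd (f : (κ → ℝ) → ℝ) (z v : κ → ℝ) :
    fderiv ℝ f z v = ∑ k, v k * pd k f z := by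
  conv_lhs => rw [← (Pi.basisFun ℝ κ).sum_repr v]
  simp [pd]

lemma contDiffAt_pd {r s : WithTop ℕ∞} (hf : ContDiffAt ℝ s f z) (hrs : r + 1 ≤ s) (k : κ) :
    ContDiffAt ℝ r (pd k f) z :=
  (hf.fderiv_right hrs).clm_apply contDiffAt_const

end PartialDerivatives

section MatrixCalculus

variable {E : Type*} [NormedAddCommGroup E] [NormedSpace ℝ E] {l m n : Type*}
  [Fintype m] {r : WithTop ℕ∞} {z : E}

lemma contDiffAt_matrix_mul {X : E → Matrix l m ℝ} {Y : E → Matrix m n ℝ}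
    (hX : ∀ i j, ContDiffAt ℝ r (fun w => X w i j) z)
    (hY : ∀ i j, ContDiffAt ℝ r (fun w => Y w i j) z) (i : l) (j : n) :
    ContDiffAt ℝ r (fun w => (X w * Y w) i j) z :=
  ContDiffAt.sum fun k _ => (hX i k).mul (hY k j)

variable [DecidableEq m] {h : E → Matrix m m ℝ}

lemma contDiffAt_matrix_det (hh : ∀ i j, ContDiffAt ℝ r (fun w => h w i j) z) :
    ContDiffAt ℝ r (fun w => (h w).det) z := by
  simp only [Matrix.det_apply]
  exact ContDiffAt.sum fun σ _ => (contDiffAt_prod fun i _ => hh _ _).const_smul _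

lemma contDiffAt_matrix_inv (hh : ∀ i j, ContDiffAt ℝ r (fun w => h w i j) z)
    (hd : (h z).det ≠ 0) (i j : m) : ContDiffAt ℝ r (fun w => (h w)⁻¹ i j) z := by
  simp only [Matrix.inv_def, Matrix.smul_apply, Matrix.adjugate_apply, smul_eq_mul,
    Ring.inverse_eq_inv']
  refine ((contDiffAt_matrix_det hh).inv hd).mul (contDiffAt_matrix_det fun a b => ?_)
  simp only [Matrix.updateRow_apply]
  split_ifs
  exacts [contDiffAt_const, hh a b]

end MatrixCalculus

section PdMatrix

variable {κ : Type*} [DecidableEq κ] {l m n : Type*} {z : κ → ℝ}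

/-- The entrywise partial derivative `∂_k X` of a matrix-valued function. -/
noncomputable def pdMatrix (k : κ) (X : (κ → ℝ) → Matrix m n ℝ) (z : κ → ℝ) : Matrix m n ℝ :=
  Matrix.of fun i j => pd k (fun w => X w i j) z

lemma pdMatrix_congr {X Y : (κ → ℝ) → Matrix m n ℝ} (h : X =ᶠ[𝓝 z] Y) (k : κ) :
    pdMatrix k X z = pdMatrix k Y z := by
  ext i j
  exact pd_congr (h.fun_comp fun M => M i j) k

lemma transpose_pdMatrix {X : (κ → ℝ) → Matrix m m ℝ} (hs : ∀ᶠ w in 𝓝 z, (X w).IsSymm) (k : κ) :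
    (pdMatrix k X z).transpose = pdMatrix k X z :=
  (pdMatrix_congr (Y := fun w => (X w).transpose) (hs.mono fun _ hw => hw.symm) k).symm

variable [Finite κ] [Fintype m]

lemma pdMatrix_mul {X : (κ → ℝ) → Matrix l m ℝ} {Y : (κ → ℝ) → Matrix m n ℝ}
    (hX : ∀ i j, DifferentiableAt ℝ (fun w => X w i j) z)
    (hY : ∀ i j, DifferentiableAt ℝ (fun w => Y w i j) z) (k : κ) :
    pdMatrix k (fun w => X w * Y w) z = pdMatrix k X z * Y z + X z * pdMatrix k Y z := by
  cases nonempty_fintype κ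
  ext i j
  simp only [pdMatrix, Matrix.of_apply, Matrix.add_apply, Matrix.mul_apply,
    ← Finset.sum_add_distrib]
  rw [pd_sum (f := fun a w => X w i a * Y w a j) k fun a _ => (hX i a).mul (hY a j)]
  exact Finset.sum_congr rfl fun a _ => pd_mul k (hX i a) (hY a j)

lemma pd_trace {X : (κ → ℝ) → Matrix m m ℝ}
    (hX : ∀ i, DifferentiableAt ℝ (fun w => X w i i) z) (k : κ) :
    pd k (fun w => (X w).trace) z = (pdMatrix k X z).trace :=
  pd_sum (f := fun i w => X w i i) k fun i _ => hX i

variable [DecidableEq m] {h : (κ → ℝ) → Matrix m m ℝ}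

lemma hasFDerivAt_det (hh : ∀ i j, DifferentiableAt ℝ (fun w => h w i j) z) :
    ∃ D : (κ → ℝ) →L[ℝ] ℝ, HasFDerivAt (fun w => (h w).det) D z ∧ ∀ k, D (Pi.single k 1)
      = ∑ i, ((h z).updateRow i (pdMatrix k h z i)).det := by
  cases nonempty_fintype κ
  let D : ContinuousMultilinearMap ℝ (fun _ : m => m → ℝ) ℝ :=
    ⟨(Matrix.detRowAlternating (n := m) (R := ℝ)).toMultilinearMap,
      Continuous.matrix_det continuous_id⟩
  have rows : HasFDerivAt (fun w i => h w i)
      (ContinuousLinearMap.pi fun i => ContinuousLinearMap.pi fun j =>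
        fderiv ℝ (fun w => h w i j) z) z :=
    hasFDerivAt_pi.2 fun i => hasFDerivAt_pi.2 fun j => (hh i j).hasFDerivAt
  exact ⟨_, (D.hasFDerivAt (h z)).comp z rows, fun k => D.linearDeriv_apply (fun i => h z i) _⟩

/-- Jacobi's formula. -/
lemma pd_det (k : κ) (hh : ∀ i j, DifferentiableAt ℝ (fun w => h w i j) z)
    (hd : (h z).det ≠ 0) :
    pd k (fun w => (h w).det) z = (h z).det * ((h z)⁻¹ * pdMatrix k h z).trace := by
  cases nonempty_fintype κ
  obtain ⟨D, hD, hDk⟩ := hasFDerivAt_det hh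
  rw [pd, hD.fderiv, hDk, Matrix.trace_mul_comm, Matrix.trace, Finset.mul_sum]
  refine Finset.sum_congr rfl fun i _ => ?_
  rw [← Matrix.cramer_transpose_apply, ← Matrix.det_smul_inv_vecMul_eq_cramer_transpose _ _
    (isUnit_iff_ne_zero.2 hd)]
  rfl

lemma pd_sqrt_det (k : κ) (hh : ∀ i j, DifferentiableAt ℝ (fun w => h w i j) z)
    (hd : 0 < (h z).det) :
    pd k (fun w => √(h w).det) z
      = √(h z).det * (1 / 2 * ((h z)⁻¹ * pdMatrix k h z).trace) := by
  cases nonempty_fintype κ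
  obtain ⟨D, hD, -⟩ := hasFDerivAt_det hh
  have jacobi := pd_det k hh hd.ne'
  have hs : √(h z).det ≠ 0 := (Real.sqrt_pos.2 hd).ne'
  rw [pd, hD.fderiv] at jacobi
  rw [pd, (hD.sqrt hd.ne').fderiv, smul_apply, jacobi, smul_eq_mul]
  field_simp
  rw [Real.sq_sqrt hd.le]

end PdMatrix

/-! ### Ricci curvature in the direction of a Killing field -/

section Killing

open Matrix

lemma trace_mul_eq_zero_of_skew {κ R : Type*} [Fintype κ] [CommRing R] [NoZeroDivisors R]
    [CharZero R] {V S : Matrix κ κ R} (hV : Vᵀ = -V) (hS : Sᵀ = S) : (V * S).trace = 0 := by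
  rw [← self_eq_neg]
  nth_rw 1 [← trace_transpose, transpose_mul, hV, hS, Matrix.mul_neg, trace_neg, trace_mul_comm]

lemma trace_mul_skewPart {κ : Type*} [Fintype κ] {V : Matrix κ κ ℝ} (hV : Vᵀ = -V)
    (D : Matrix κ κ ℝ) : (V * ((1 / 2 : ℝ) • (D - Dᵀ))).trace = (V * D).trace := by
  have hD : (V * Dᵀ).trace = -(V * D).trace := by
    rw [← trace_transpose, transpose_mul, hV, transpose_transpose, Matrix.mul_neg, trace_neg,
      trace_mul_comm]
  rw [Matrix.mul_smul, trace_smul, Matrix.mul_sub, trace_sub, hD, smul_eq_mul]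
  ring

/-- Half the exterior derivative of the one-form `h_{Ij} dz^j`, as the matrix with entries
`½ (∂_j h_{Il} - ∂_l h_{Ij})` at `(l, j)`. -/
noncomputable def halfCurl {κ : Type*} [DecidableEq κ] (h : (κ → ℝ) → Matrix κ κ ℝ) (I : κ)
    (w : κ → ℝ) : Matrix κ κ ℝ :=
  (1 / 2 : ℝ) • (of (fun l j => pd j (fun w => h w I l) w)
    - (of fun l j => pd j (fun w => h w I l) w)ᵀ)

lemma transpose_halfCurl {κ : Type*} [DecidableEq κ] (h : (κ → ℝ) → Matrix κ κ ℝ) (I : κ)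
    (w : κ → ℝ) : (halfCurl h I w)ᵀ = -halfCurl h I w := by
  rw [halfCurl, transpose_smul, transpose_sub, transpose_transpose, ← smul_neg, neg_sub]

variable {κ : Type*} [Fintype κ] [DecidableEq κ]

/-- Half the exterior derivative of the one-form `h_{Ij} dz^j`, with both indices raised. If `∂_I`
is a Killing field, this is its covariant derivative. -/
noncomputable def raisedCurl (h : (κ → ℝ) → Matrix κ κ ℝ) (I : κ) (w : κ → ℝ) : Matrix κ κ ℝ :=
  (h w)⁻¹ * halfCurl h I w * (h w)⁻¹

/-- The matrix `Γ_i` with the entry `Γ^k_{ij}` at `(k, j)`. -/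
noncomputable def christoffelMatrix (h : (κ → ℝ) → Matrix κ κ ℝ) (i : κ) (w : κ → ℝ) :
    Matrix κ κ ℝ :=
  Matrix.of fun k j => christoffel h k i j w

/-- The divergence density `∂_k (√(det h) V^{kp})` of a tensor field `V` with two upper indices. -/
noncomputable def divDensity (h V : (κ → ℝ) → Matrix κ κ ℝ) (z : κ → ℝ) (p : κ) : ℝ :=
  ∑ k, pd k (fun w => √(h w).det * V w k p) z

/-- `h` is a `C²` metric (of positive determinant) near `z` for which `∂_I` is a Killing field. -/
structure IsKillingCoord (h : (κ → ℝ) → Matrix κ κ ℝ) (I : κ) (z : κ → ℝ) : Prop where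
  contDiffAt : ∀ i j, ContDiffAt ℝ 2 (fun w => h w i j) z
  isSymm : ∀ᶠ w in 𝓝 z, (h w).IsSymm
  det_pos : 0 < (h z).det
  pdMatrix_eq_zero : ∀ᶠ w in 𝓝 z, pdMatrix I h w = 0

variable {h : (κ → ℝ) → Matrix κ κ ℝ} {I : κ} {z : κ → ℝ}

lemma transpose_raisedCurl (hs : (h z).IsSymm) : (raisedCurl h I z)ᵀ = -raisedCurl h I z := by
  simp only [raisedCurl, transpose_mul, hs.inv.eq, transpose_halfCurl, Matrix.neg_mul,
    Matrix.mul_neg, Matrix.mul_assoc]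

lemma raisedCurl_add_right {v : κ → ℝ} (hf : ∀ w, h (w + v) = h w) (w : κ → ℝ) :
    raisedCurl h I (w + v) = raisedCurl h I w := by
  simp only [raisedCurl, halfCurl, hf,
    fun k a b => pd_add_right (f := fun w => h w a b) (fun w => by rw [hf w]) k w]

lemma contDiffAt_halfCurl (hh : ∀ i j, ContDiffAt ℝ 2 (fun w => h w i j) z) (l j : κ) :
    ContDiffAt ℝ 1 (fun w => halfCurl h I w l j) z :=
  have hpd := fun k i j => contDiffAt_pd (r := 1) (hh i j) one_add_one_eq_two.le k
  contDiffAt_const.mul ((hpd j I l).sub (hpd l I j))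

lemma contDiffAt_raisedCurl (hh : ∀ i j, ContDiffAt ℝ 2 (fun w => h w i j) z)
    (hd : (h z).det ≠ 0) (k p : κ) : ContDiffAt ℝ 1 (fun w => raisedCurl h I w k p) z :=
  have hinv := contDiffAt_matrix_inv (fun i j => (hh i j).of_le one_le_two) hd
  contDiffAt_matrix_mul (contDiffAt_matrix_mul hinv (contDiffAt_halfCurl hh)) hinv k p

lemma contDiffAt_christoffel (hh : ∀ i j, ContDiffAt ℝ 2 (fun w => h w i j) z)
    (hd : (h z).det ≠ 0) (k i j : κ) : ContDiffAt ℝ 1 (christoffel h k i j) z :=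
  have hinv := contDiffAt_matrix_inv (fun i j => (hh i j).of_le one_le_two) hd
  have hpd := fun k i j => contDiffAt_pd (r := 1) (hh i j) one_add_one_eq_two.le k
  contDiffAt_const.mul <| ContDiffAt.sum fun l _ =>
    (hinv k l).mul (((hpd i j l).add (hpd j i l)).sub (hpd l i j))

lemma christoffel_symm (hs : ∀ᶠ w in 𝓝 z, (h w).IsSymm) (k i j : κ) :
    christoffel h k i j z = christoffel h k j i z := by
  simp only [christoffel, pd_congr (hs.mono fun _ hw => hw.apply j i)]
  refine congrArg _ (Finset.sum_congr rfl fun l _ => ?_)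
  ring

lemma christoffelMatrix_eq (h : (κ → ℝ) → Matrix κ κ ℝ) (i : κ) (w : κ → ℝ) :
    christoffelMatrix h i w = (h w)⁻¹ * ((1 / 2 : ℝ) • (pdMatrix i h w)ᵀ + halfCurl h i w) := by
  ext k j
  simp only [christoffelMatrix, christoffel, halfCurl, pdMatrix, of_apply, mul_apply,
    Matrix.add_apply, Matrix.sub_apply, Matrix.smul_apply, transpose_apply, smul_eq_mul,
    Finset.mul_sum]
  refine Finset.sum_congr rfl fun l _ => ?_
  ring

lemma trace_christoffelMatrix (hs : ∀ᶠ w in 𝓝 z, (h w).IsSymm) (i : κ) :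
    (christoffelMatrix h i z).trace = 1 / 2 * ((h z)⁻¹ * pdMatrix i h z).trace := by
  rw [christoffelMatrix_eq, transpose_pdMatrix hs, Matrix.mul_add, trace_add,
    trace_mul_comm _ (halfCurl h i z),
    trace_mul_eq_zero_of_skew (transpose_halfCurl h i z) hs.self_of_nhds.inv.eq,
    Matrix.mul_smul, trace_smul, smul_eq_mul, add_zero]

lemma ricci_eq_matrix (hs : ∀ᶠ w in 𝓝 z, (h w).IsSymm) (i j : κ)
    (hΓ : ∀ k, DifferentiableAt ℝ (christoffel h k i k) z) :
    ricci h i j z = ∑ k, pdMatrix k (christoffelMatrix h i) z k j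
      - pd j (fun w => (christoffelMatrix h i w).trace) z
      + ((fun l => (christoffelMatrix h l z).trace) ᵥ* christoffelMatrix h i z) j
      - (christoffelMatrix h j z * christoffelMatrix h i z).trace := by
  have contraction : ∑ k, ∑ l, christoffel h k k l z * christoffel h l i j z
      = ((fun l => (christoffelMatrix h l z).trace) ᵥ* christoffelMatrix h i z) j := by
    rw [Finset.sum_comm]
    simp only [← Finset.sum_mul]
    exact Finset.sum_congr rfl fun l _ => congrArg (· * _) <|
      Finset.sum_congr rfl fun k _ => christoffel_symm hs k k l
  rw [pd_trace hΓ, ricci, contraction]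
  rfl

namespace IsKillingCoord

lemma eventually_christoffelMatrix_eq (H : IsKillingCoord h I z) :
    ∀ᶠ w in 𝓝 z, christoffelMatrix h I w = raisedCurl h I w * h w := by
  have hdet : ContinuousAt (fun w => (h w).det) z :=
    (contDiffAt_matrix_det H.contDiffAt).continuousAt
  filter_upwards [hdet.eventually_ne H.det_pos.ne', H.pdMatrix_eq_zero] with w hw hK
  rw [christoffelMatrix_eq, hK, raisedCurl, nonsing_inv_mul_cancel_right _ _ hw.isUnit,
    transpose_zero, smul_zero, zero_add]

lemma trace_christoffelMatrix_eventuallyEq (H : IsKillingCoord h I z) :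
    (fun w => (christoffelMatrix h I w).trace) =ᶠ[𝓝 z] fun _ => 0 := by
  filter_upwards [H.eventually_christoffelMatrix_eq, H.isSymm] with w hw hs
  rw [hw, trace_mul_eq_zero_of_skew (transpose_raisedCurl hs) hs.eq]

lemma differentiableAt_raisedCurl (H : IsKillingCoord h I z) (i j : κ) :
    DifferentiableAt ℝ (fun w => raisedCurl h I w i j) z :=
  (contDiffAt_raisedCurl H.contDiffAt H.det_pos.ne' i j).differentiableAt one_ne_zero

lemma differentiableAt (H : IsKillingCoord h I z) (i j : κ) :
    DifferentiableAt ℝ (fun w => h w i j) z :=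
  (H.contDiffAt i j).differentiableAt two_ne_zero

lemma sum_pdMatrix_christoffelMatrix (H : IsKillingCoord h I z) (j : κ) :
    ∑ k, pdMatrix k (christoffelMatrix h I) z k j
      = ((fun p => ∑ k, pdMatrix k (raisedCurl h I) z k p) ᵥ* h z) j
        + ∑ k, (raisedCurl h I z * pdMatrix k h z) k j := by
  simp only [pdMatrix_congr H.eventually_christoffelMatrix_eq,
    pdMatrix_mul H.differentiableAt_raisedCurl H.differentiableAt, Matrix.add_apply,
    Finset.sum_add_distrib, mul_apply, vecMul, dotProduct, Finset.sum_mul]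
  rw [Finset.sum_comm]

lemma trace_christoffelMatrix_mul (H : IsKillingCoord h I z) (j : κ) :
    (christoffelMatrix h j z * christoffelMatrix h I z).trace
      = ∑ k, (raisedCurl h I z * pdMatrix k h z) k j := by
  have hskew := transpose_raisedCurl (I := I) H.isSymm.self_of_nhds
  calc (christoffelMatrix h j z * christoffelMatrix h I z).trace
      = (((1 / 2 : ℝ) • pdMatrix j h z + halfCurl h j z) * raisedCurl h I z).trace := by
        rw [H.eventually_christoffelMatrix_eq.self_of_nhds, christoffelMatrix_eq,
          transpose_pdMatrix H.isSymm, ← Matrix.mul_assoc, trace_mul_comm, Matrix.mul_assoc,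
          mul_nonsing_inv_cancel_left _ _ H.det_pos.ne'.isUnit]
    _ = (raisedCurl h I z * halfCurl h j z).trace := by
        rw [trace_mul_comm, Matrix.mul_add, trace_add, trace_mul_eq_zero_of_skew hskew, zero_add]
        rw [transpose_smul, transpose_pdMatrix H.isSymm]
    _ = (raisedCurl h I z * of fun p k => pd k (fun w => h w j p) z).trace := by
        rw [halfCurl, trace_mul_skewPart hskew]
    _ = ∑ k, (raisedCurl h I z * pdMatrix k h z) k j := by
        simp only [pd_congr (H.isSymm.mono fun _ hw => hw.apply _ j)]
        rfl

lemma divDensity_raisedCurl (H : IsKillingCoord h I z) :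
    divDensity h (raisedCurl h I) z = √(h z).det •
      ((fun l => (christoffelMatrix h l z).trace) ᵥ* raisedCurl h I z
        + fun p => ∑ k, pdMatrix k (raisedCurl h I) z k p) := by
  ext p
  have hsqrt : DifferentiableAt ℝ (fun w => √(h w).det) z :=
    ((contDiffAt_matrix_det H.contDiffAt).differentiableAt two_ne_zero).sqrt H.det_pos.ne'
  simp only [divDensity, fun k => pd_mul k hsqrt (H.differentiableAt_raisedCurl k p),
    fun k => pd_sqrt_det k H.differentiableAt H.det_pos, ← trace_christoffelMatrix H.isSymm,
    Finset.sum_add_distrib, mul_assoc, ← Finset.mul_sum, ← mul_add]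
  rfl

theorem sqrt_det_mul_ricci (H : IsKillingCoord h I z) (j : κ) :
    √(h z).det * ricci h I j z = (divDensity h (raisedCurl h I) z ᵥ* h z) j := by
  have hΓ := fun k => (contDiffAt_christoffel H.contDiffAt H.det_pos.ne' k I k).differentiableAt
    one_ne_zero
  rw [ricci_eq_matrix H.isSymm I j hΓ, pd_congr H.trace_christoffelMatrix_eventuallyEq, pd_const,
    H.sum_pdMatrix_christoffelMatrix, H.trace_christoffelMatrix_mul, H.divDensity_raisedCurl,
    H.eventually_christoffelMatrix_eq.self_of_nhds, ← vecMul_vecMul, smul_vecMul, add_vecMul,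
    Pi.smul_apply, Pi.add_apply, smul_eq_mul]
  ring

end IsKillingCoord

end Killing

section Congr

variable {κ : Type*} [Fintype κ] [DecidableEq κ] {h h' : (κ → ℝ) → Matrix κ κ ℝ} {z : κ → ℝ}

lemma eventuallyEq_christoffel (H : h =ᶠ[𝓝 z] h') (k i j : κ) :
    christoffel h k i j =ᶠ[𝓝 z] christoffel h' k i j := by
  filter_upwards [H.eventuallyEq_nhds] with w hw
  have entry : ∀ a b, (fun w => h w a b) =ᶠ[𝓝 w] fun w => h' w a b := fun a b =>
    hw.fun_comp fun M => M a b
  simp only [christoffel, hw.self_of_nhds, fun k a b => pd_congr (entry a b) k]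

lemma ricci_congr (H : h =ᶠ[𝓝 z] h') (i j : κ) : ricci h i j z = ricci h' i j z := by
  simp only [ricci, fun k i j => (eventuallyEq_christoffel H k i j).self_of_nhds,
    fun k i j l => pd_congr (eventuallyEq_christoffel H k i j) l]

end Congr

/-! ### Kaluza-Klein metrics -/

section KaluzaKlein

open Matrix

variable {μ ν : Type*}

/-- The projection to the base coordinates. -/
def baseCoord (μ ν : Type*) : (μ ⊕ ν → ℝ) →L[ℝ] (μ → ℝ) :=
  ContinuousLinearMap.pi fun α => ContinuousLinearMap.proj (Sum.inl α)

/-- The curvature `F_{αβ} = ∂_α A_β - ∂_β A_α` of the component `A = A_α db^α` of a connection. -/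
noncomputable def curvature [DecidableEq μ] (A : (μ → ℝ) → μ → ℝ) (y : μ → ℝ) : Matrix μ μ ℝ :=
  Matrix.of fun α β => pd α (fun w => A w β) y - pd β (fun w => A w α) y

variable [DecidableEq μ] [DecidableEq ν]

/-- The matrix of the coframe `(db^α, dx^I + A^I)`. The columns of `coframe (-A)` are the
components of the dual frame, which consists of the horizontal lifts `∂_α - A^I_α ∂_I` and the
vertical fields `∂_I`. -/
def coframe (A : Matrix ν μ ℝ) : Matrix (μ ⊕ ν) (μ ⊕ ν) ℝ :=
  Matrix.fromBlocks 1 0 A 1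

lemma baseCoord_single_inl (α : μ) :
    baseCoord μ ν (Pi.single (Sum.inl α) 1) = Pi.single α 1 := by
  ext β
  simp [baseCoord, Pi.single_apply]

lemma baseCoord_single_inr (I : ν) : baseCoord μ ν (Pi.single (Sum.inr I) 1) = 0 := by
  ext β
  simp [baseCoord]

lemma pd_inr_comp_baseCoord [Finite μ] [Finite ν] (f : (μ → ℝ) → ℝ) (I : ν) (z : μ ⊕ ν → ℝ) :
    pd (Sum.inr I) (fun w => f (baseCoord μ ν w)) z = 0 :=
  pd_eq_zero_of_invariant fun t => by
    rw [map_add, map_smul, baseCoord_single_inr, smul_zero, add_zero]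

lemma pd_inl_comp_baseCoord [Finite μ] [Finite ν] {f : (μ → ℝ) → ℝ} {z : μ ⊕ ν → ℝ}
    (hf : DifferentiableAt ℝ f (baseCoord μ ν z)) (α : μ) :
    pd (Sum.inl α) (fun w => f (baseCoord μ ν w)) z = pd α f (baseCoord μ ν z) := by
  cases nonempty_fintype μ
  cases nonempty_fintype ν
  have chain := (hf.hasFDerivAt.comp z (baseCoord μ ν).hasFDerivAt).fderiv
  rw [pd, pd, ← baseCoord_single_inl (ν := ν) α, ← ContinuousLinearMap.comp_apply, ← chain]
  rfl

variable [Fintype μ] [Fintype ν]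

lemma coframe_mul_coframe_neg (A : Matrix ν μ ℝ) : coframe A * coframe (-A) = 1 := by
  simp [coframe, fromBlocks_multiply]

lemma vecMul_coframe_neg_inl (v : μ ⊕ ν → ℝ) (A : Matrix ν μ ℝ) (α : μ) :
    (v ᵥ* coframe (-A)) (Sum.inl α) = v (Sum.inl α) - ∑ J, A J α * v (Sum.inr J) := by
  simp [coframe, vecMul, dotProduct, Matrix.one_apply, mul_comm, sub_eq_add_neg]

/-- The matrix of `G_{IJ} (dx^I + A^I) (dx^J + A^J) + g_{αβ} db^α db^β`. -/
def kkMatrix (g : Matrix μ μ ℝ) (A : Matrix ν μ ℝ) (G : Matrix ν ν ℝ) :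
    Matrix (μ ⊕ ν) (μ ⊕ ν) ℝ :=
  (coframe A)ᵀ * Matrix.fromBlocks g 0 0 G * coframe A

lemma kkMatrix_eq_fromBlocks (g : Matrix μ μ ℝ) (A : Matrix ν μ ℝ) (G : Matrix ν ν ℝ) :
    kkMatrix g A G = fromBlocks (g + Aᵀ * G * A) (Aᵀ * G) (G * A) G := by
  simp [kkMatrix, coframe, fromBlocks_transpose, fromBlocks_multiply]

lemma det_kkMatrix (g : Matrix μ μ ℝ) (A : Matrix ν μ ℝ) (G : Matrix ν ν ℝ) :
    (kkMatrix g A G).det = g.det * G.det := by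
  simp [kkMatrix, coframe, det_mul, det_transpose]

lemma kkMatrix_mul_coframe_neg (g : Matrix μ μ ℝ) (A : Matrix ν μ ℝ) (G : Matrix ν ν ℝ) :
    kkMatrix g A G * coframe (-A) = fromBlocks g (Aᵀ * G) 0 G := by
  rw [kkMatrix, Matrix.mul_assoc, coframe_mul_coframe_neg, Matrix.mul_one]
  simp [coframe, fromBlocks_transpose, fromBlocks_multiply]

lemma isSymm_kkMatrix {g : Matrix μ μ ℝ} {G : Matrix ν ν ℝ} (hg : g.IsSymm) (A : Matrix ν μ ℝ)
    (hG : G.IsSymm) : (kkMatrix g A G).IsSymm := by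
  simp only [kkMatrix, Matrix.IsSymm, transpose_mul, transpose_transpose, fromBlocks_transpose,
    hg.eq, hG.eq, transpose_zero, Matrix.mul_assoc]

lemma inv_kkMatrix {g : Matrix μ μ ℝ} {G : Matrix ν ν ℝ} (hg : g.det ≠ 0) (A : Matrix ν μ ℝ)
    (hG : G.det ≠ 0) : (kkMatrix g A G)⁻¹
      = coframe (-A) * fromBlocks g⁻¹ 0 0 G⁻¹ * (coframe (-A))ᵀ := by
  have hD : fromBlocks g 0 0 G * fromBlocks g⁻¹ 0 0 G⁻¹ = 1 := by
    simp [fromBlocks_multiply, mul_nonsing_inv _ hg.isUnit, mul_nonsing_inv _ hG.isUnit]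
  have hC : coframe (-A) * coframe A = 1 := by simpa using coframe_mul_coframe_neg (-A)
  refine inv_eq_right_inv ?_
  calc kkMatrix g A G * (coframe (-A) * fromBlocks g⁻¹ 0 0 G⁻¹ * (coframe (-A))ᵀ)
      = (coframe A)ᵀ * (fromBlocks g 0 0 G * (coframe A * coframe (-A)) * fromBlocks g⁻¹ 0 0 G⁻¹)
          * (coframe (-A))ᵀ := by simp only [kkMatrix, Matrix.mul_assoc]
    _ = 1 := by
      rw [coframe_mul_coframe_neg, Matrix.mul_one, hD, Matrix.mul_one, ← transpose_mul, hC,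
        transpose_one]

lemma toBlocks₁₁_inv_kkMatrix_mul {g : Matrix μ μ ℝ} {G : Matrix ν ν ℝ} (hg : g.det ≠ 0)
    (A : Matrix ν μ ℝ) (hG : G.det ≠ 0) (K : Matrix (μ ⊕ ν) (μ ⊕ ν) ℝ) :
    ((kkMatrix g A G)⁻¹ * K * (kkMatrix g A G)⁻¹).toBlocks₁₁
      = g⁻¹ * ((coframe (-A))ᵀ * K * coframe (-A)).toBlocks₁₁ * g⁻¹ := by
  have outer : ∀ X, (coframe (-A) * fromBlocks g⁻¹ 0 0 G⁻¹ * X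
      * (fromBlocks g⁻¹ 0 0 G⁻¹ * (coframe (-A))ᵀ)).toBlocks₁₁ = g⁻¹ * X.toBlocks₁₁ * g⁻¹ := by
    intro X
    rw [← fromBlocks_toBlocks X]
    simp [coframe, fromBlocks_transpose, fromBlocks_multiply]
  rw [inv_kkMatrix hg A hG, ← outer]
  simp only [Matrix.mul_assoc]

variable {g : (μ → ℝ) → Matrix μ μ ℝ} {A : (μ → ℝ) → Matrix ν μ ℝ} {G : (μ → ℝ) → Matrix ν ν ℝ}

/-- The metric `G_{IJ} (dx^I + A^I) (dx^J + A^J) + g_{αβ} db^α db^β`, with coefficients depending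
only on the base coordinates. -/
def kkMetric (g : (μ → ℝ) → Matrix μ μ ℝ) (A : (μ → ℝ) → Matrix ν μ ℝ)
    (G : (μ → ℝ) → Matrix ν ν ℝ) (z : μ ⊕ ν → ℝ) : Matrix (μ ⊕ ν) (μ ⊕ ν) ℝ :=
  kkMatrix (g (baseCoord μ ν z)) (A (baseCoord μ ν z)) (G (baseCoord μ ν z))

/-- Near `y`, the coefficients `g`, `A` and `G` are `C²` and define a Kaluza-Klein metric for which
`g` and `G` have positive determinants. -/
structure IsKaluzaKleinAt (g : (μ → ℝ) → Matrix μ μ ℝ) (A : (μ → ℝ) → Matrix ν μ ℝ)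
    (G : (μ → ℝ) → Matrix ν ν ℝ) (y : μ → ℝ) : Prop where
  contDiffAt_g : ∀ α β, ContDiffAt ℝ 2 (fun w => g w α β) y
  contDiffAt_A : ∀ I β, ContDiffAt ℝ 2 (fun w => A w I β) y
  contDiffAt_G : ∀ I J, ContDiffAt ℝ 2 (fun w => G w I J) y
  isSymm_g : ∀ᶠ w in 𝓝 y, (g w).IsSymm
  isSymm_G : ∀ᶠ w in 𝓝 y, (G w).IsSymm
  det_g_pos : 0 < (g y).det
  det_G_pos : 0 < (G y).det

lemma fiber_row_pd_kkMetric {z : μ ⊕ ν → ℝ}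
    (hA : ∀ I β, DifferentiableAt ℝ (fun w => A w I β) (baseCoord μ ν z))
    (hG : ∀ I J, DifferentiableAt ℝ (fun w => G w I J) (baseCoord μ ν z)) (I : ν) :
    (of fun l j => pd j (fun w => kkMetric g A G w (Sum.inr I) l) z)
      = fromBlocks (of fun α β => ∑ J,
        (pd β (fun w => G w I J) (baseCoord μ ν z) * A (baseCoord μ ν z) J α
          + G (baseCoord μ ν z) I J * pd β (fun w => A w J α) (baseCoord μ ν z))) 0
        (of fun J β => pd β (fun w => G w I J) (baseCoord μ ν z)) 0 := by
  have hGA : ∀ α J, DifferentiableAt ℝ (fun w => G w I J * A w J α) (baseCoord μ ν z) :=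
    fun α J => (hG I J).mul (hA J α)
  ext (α | J) (β | K)
  · simp only [of_apply, fromBlocks_apply₁₁, ← fun J => pd_mul β (hG I J) (hA J α),
      ← pd_sum β fun J _ => hGA α J]
    rw [← pd_inl_comp_baseCoord (DifferentiableAt.fun_sum fun J _ => hGA α J)]
    simp only [kkMetric, kkMatrix_eq_fromBlocks, fromBlocks_apply₂₁, mul_apply]
  · exact pd_inr_comp_baseCoord (fun y => kkMatrix (g y) (A y) (G y) (Sum.inr I) _) K z
  · rw [of_apply, fromBlocks_apply₂₁, of_apply, ← pd_inl_comp_baseCoord (hG I J)]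
    simp only [kkMetric, kkMatrix_eq_fromBlocks, fromBlocks_apply₂₂]
  · exact pd_inr_comp_baseCoord (fun y => kkMatrix (g y) (A y) (G y) (Sum.inr I) _) K z

lemma toBlocks₁₁_halfCurl_kkMetric {z : μ ⊕ ν → ℝ}
    (hA : ∀ I β, DifferentiableAt ℝ (fun w => A w I β) (baseCoord μ ν z))
    (hG : ∀ I J, DifferentiableAt ℝ (fun w => G w I J) (baseCoord μ ν z)) (I : ν) :
    ((coframe (-A (baseCoord μ ν z)))ᵀ * halfCurl (kkMetric g A G) (Sum.inr I) z
        * coframe (-A (baseCoord μ ν z))).toBlocks₁₁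
      = -(1 / 2 : ℝ) • ∑ J, G (baseCoord μ ν z) I J •
        curvature (fun w => A w J) (baseCoord μ ν z) := by
  rw [halfCurl, fiber_row_pd_kkMetric hA hG]
  ext α β
  simp only [coframe, fromBlocks_transpose, sub_eq_add_neg, fromBlocks_neg, fromBlocks_add,
    fromBlocks_smul, fromBlocks_multiply, toBlocks_fromBlocks₁₁]
  simp only [Matrix.add_apply, Matrix.smul_apply, Matrix.neg_apply, Matrix.mul_apply,
    Matrix.sum_apply, Matrix.one_mul, Matrix.mul_one, Matrix.mul_zero, Matrix.mul_neg, neg_zero,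
    transpose_zero, transpose_one, transpose_apply, add_zero, zero_add, of_apply, smul_eq_mul,
    smul_zero, curvature, Finset.mul_sum, ← Finset.sum_add_distrib, ← Finset.sum_neg_distrib]
  refine Finset.sum_congr rfl fun J _ => ?_
  ring

namespace IsKaluzaKleinAt

lemma eventually {y : μ → ℝ} (H : IsKaluzaKleinAt g A G y) :
    ∀ᶠ w in 𝓝 y, IsKaluzaKleinAt g A G w := by
  have ev_g := fun α β => (H.contDiffAt_g α β).eventually (by simp)
  have ev_A := fun I β => (H.contDiffAt_A I β).eventually (by simp)
  have ev_G := fun I J => (H.contDiffAt_G I J).eventually (by simp)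
  simp only [← Filter.eventually_all] at ev_g ev_A ev_G
  filter_upwards [ev_g, ev_A, ev_G, H.isSymm_g.eventually_nhds, H.isSymm_G.eventually_nhds,
    (contDiffAt_matrix_det H.contDiffAt_g).continuousAt.eventually_const_lt H.det_g_pos,
    (contDiffAt_matrix_det H.contDiffAt_G).continuousAt.eventually_const_lt H.det_G_pos]
    with w h₁ h₂ h₃ h₄ h₅ h₆ h₇ using ⟨h₁, h₂, h₃, h₄, h₅, h₆, h₇⟩

variable {z : μ ⊕ ν → ℝ} (H : IsKaluzaKleinAt g A G (baseCoord μ ν z))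
include H

lemma eventually_comp_baseCoord :
    ∀ᶠ w in 𝓝 z, IsKaluzaKleinAt g A G (baseCoord μ ν w) :=
  (baseCoord μ ν).continuous.continuousAt.eventually H.eventually

lemma det_kkMetric_pos : 0 < (kkMetric g A G z).det := by
  rw [kkMetric, det_kkMatrix]
  exact mul_pos H.det_g_pos H.det_G_pos

lemma contDiffAt_kkMetric (i j : μ ⊕ ν) : ContDiffAt ℝ 2 (fun w => kkMetric g A G w i j) z := by
  have hD : ∀ i j, ContDiffAt ℝ 2 (fun y => fromBlocks (g y) 0 0 (G y) i j) (baseCoord μ ν z) := by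
    rintro (α | I) (β | J)
    exacts [H.contDiffAt_g α β, contDiffAt_const, contDiffAt_const, H.contDiffAt_G I J]
  have hC : ∀ i j, ContDiffAt ℝ 2 (fun y => coframe (A y) i j) (baseCoord μ ν z) := by
    rintro (α | I) (β | J)
    exacts [contDiffAt_const, contDiffAt_const, H.contDiffAt_A I β, contDiffAt_const]
  exact (contDiffAt_matrix_mul (contDiffAt_matrix_mul (fun i j => hC j i) hD) hC i j).comp z
    (baseCoord μ ν).contDiff.contDiffAt

lemma isKillingCoord (I : ν) : IsKillingCoord (kkMetric g A G) (Sum.inr I) z where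
  contDiffAt := H.contDiffAt_kkMetric
  isSymm := H.eventually_comp_baseCoord.mono fun _ hw =>
    isSymm_kkMatrix hw.isSymm_g.self_of_nhds _ hw.isSymm_G.self_of_nhds
  det_pos := H.det_kkMetric_pos
  pdMatrix_eq_zero := .of_forall fun w => by
    ext i j
    exact pd_inr_comp_baseCoord (fun y => kkMatrix (g y) (A y) (G y) i j) I w

lemma toBlocks₁₁_raisedCurl (I : ν) :
    (raisedCurl (kkMetric g A G) (Sum.inr I) z).toBlocks₁₁
      = -(1 / 2 : ℝ) • ∑ J, G (baseCoord μ ν z) I J • ((g (baseCoord μ ν z))⁻¹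
        * curvature (fun w => A w J) (baseCoord μ ν z) * (g (baseCoord μ ν z))⁻¹) := by
  rw [raisedCurl, kkMetric, toBlocks₁₁_inv_kkMatrix_mul H.det_g_pos.ne' _ H.det_G_pos.ne',
    toBlocks₁₁_halfCurl_kkMetric
      (fun I β => (H.contDiffAt_A I β).differentiableAt two_ne_zero)
      (fun I J => (H.contDiffAt_G I J).differentiableAt two_ne_zero)]
  simp only [Matrix.mul_smul, Matrix.smul_mul, Finset.mul_sum, Finset.sum_mul]

end IsKaluzaKleinAt

lemma kkMetric_add_vertical (g : (μ → ℝ) → Matrix μ μ ℝ) (A : (μ → ℝ) → Matrix ν μ ℝ)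
    (G : (μ → ℝ) → Matrix ν ν ℝ) {v : μ ⊕ ν → ℝ} (hv : baseCoord μ ν v = 0) (w : μ ⊕ ν → ℝ) :
    kkMetric g A G (w + v) = kkMetric g A G w := by
  rw [kkMetric, map_add, hv, add_zero, kkMetric]

lemma divDensity_inl_kkMetric (g : (μ → ℝ) → Matrix μ μ ℝ) (A : (μ → ℝ) → Matrix ν μ ℝ)
    (G : (μ → ℝ) → Matrix ν ν ℝ) (I : μ ⊕ ν) (z : μ ⊕ ν → ℝ) (j : μ ⊕ ν) :
    divDensity (kkMetric g A G) (raisedCurl (kkMetric g A G) I) z j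
      = ∑ γ, pd (Sum.inl γ) (fun w => √(kkMetric g A G w).det *
        raisedCurl (kkMetric g A G) I w (Sum.inl γ) j) z := by
  rw [divDensity, Fintype.sum_sum_type, add_eq_left]
  refine Finset.sum_eq_zero fun J _ => pd_eq_zero_of_invariant fun t => ?_
  have hv : baseCoord μ ν (t • Pi.single (Sum.inr J) 1) = 0 := by
    rw [map_smul, baseCoord_single_inr, smul_zero]
  rw [raisedCurl_add_right (kkMetric_add_vertical g A G hv), kkMetric_add_vertical g A G hv]

end KaluzaKlein

section Surface

open Matrix

/-- The matrix of the area form `db⁰ ∧ db¹`. -/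
def areaMatrix : Matrix (Fin 2) (Fin 2) ℝ :=
  !![0, 1; -1, 0]

lemma mul_areaMatrix_mul_transpose (X : Matrix (Fin 2) (Fin 2) ℝ) :
    X * areaMatrix * Xᵀ = X.det • areaMatrix := by
  ext i j
  fin_cases i <;> fin_cases j <;>
    simp [areaMatrix, mul_apply, det_fin_two] <;> ring

lemma curvature_fin_two (A : (Fin 2 → ℝ) → Fin 2 → ℝ) (y : Fin 2 → ℝ) :
    curvature A y = curvature A y 0 1 • areaMatrix := by
  ext i j
  fin_cases i <;> fin_cases j <;> simp [areaMatrix, curvature]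

variable {ν : Type*} [Fintype ν] [DecidableEq ν] {g : (Fin 2 → ℝ) → Matrix (Fin 2) (Fin 2) ℝ}
  {A : (Fin 2 → ℝ) → Matrix ν (Fin 2) ℝ} {G : (Fin 2 → ℝ) → Matrix ν ν ℝ}

/-- The components `√(det G) G_{IJ} F^J / dvol` of the conserved quantity of a Kaluza-Klein metric
over a surface. -/
noncomputable def kkTwist (g : (Fin 2 → ℝ) → Matrix (Fin 2) (Fin 2) ℝ)
    (A : (Fin 2 → ℝ) → Matrix ν (Fin 2) ℝ) (G : (Fin 2 → ℝ) → Matrix ν ν ℝ) (I : ν)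
    (y : Fin 2 → ℝ) : ℝ :=
  √(G y).det * ∑ J, G y I J * (curvature (fun w => A w J) y 0 1 / √(g y).det)

namespace IsKaluzaKleinAt

lemma differentiableAt_kkTwist {y : Fin 2 → ℝ} (H : IsKaluzaKleinAt g A G y) (I : ν) :
    DifferentiableAt ℝ (kkTwist g A G I) y := by
  have hA := fun J β k =>
    contDiffAt_pd (r := 1) (H.contDiffAt_A J β) one_add_one_eq_two.le k
  have hg : ContDiffAt ℝ 1 (fun w => √(g w).det) y :=
    (contDiffAt_matrix_det fun i j => (H.contDiffAt_g i j).of_le one_le_two).sqrt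
      H.det_g_pos.ne'
  have hG := fun i j => (H.contDiffAt_G i j).of_le one_le_two
  have smooth : ContDiffAt ℝ 1 (kkTwist g A G I) y :=
    ((contDiffAt_matrix_det hG).sqrt H.det_G_pos.ne').mul <| ContDiffAt.sum fun J _ =>
      (hG I J).mul (((hA J 1 0).sub (hA J 0 1)).div hg (Real.sqrt_pos.2 H.det_g_pos).ne')
  exact smooth.differentiableAt one_ne_zero

variable {z : Fin 2 ⊕ ν → ℝ} (H : IsKaluzaKleinAt g A G (baseCoord (Fin 2) ν z))
include H

lemma sqrt_det_smul_raisedCurl (I : ν) :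
    √(kkMetric g A G z).det • (raisedCurl (kkMetric g A G) (Sum.inr I) z).toBlocks₁₁
      = (-(1 / 2) * kkTwist g A G I (baseCoord (Fin 2) ν z)) • areaMatrix := by
  have hg := H.det_g_pos
  have hs : √(g (baseCoord (Fin 2) ν z)).det ≠ 0 := (Real.sqrt_pos.2 hg).ne'
  have raise : ∀ J, (g (baseCoord (Fin 2) ν z))⁻¹
      * curvature (fun w => A w J) (baseCoord (Fin 2) ν z) * (g (baseCoord (Fin 2) ν z))⁻¹
      = (curvature (fun w => A w J) (baseCoord (Fin 2) ν z) 0 1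
        / (g (baseCoord (Fin 2) ν z)).det) • areaMatrix := by
    intro J
    have area := mul_areaMatrix_mul_transpose (g (baseCoord (Fin 2) ν z))⁻¹
    rw [H.isSymm_g.self_of_nhds.inv.eq, det_nonsing_inv, Ring.inverse_eq_inv'] at area
    nth_rw 1 [curvature_fin_two]
    rw [Matrix.mul_smul, Matrix.smul_mul, area, smul_smul, div_eq_mul_inv]
  rw [H.toBlocks₁₁_raisedCurl, kkMetric, det_kkMatrix, Real.sqrt_mul hg.le, kkTwist]
  simp only [raise, smul_smul, ← Finset.sum_smul]
  congr 1
  simp only [← mul_div_assoc, ← Finset.sum_div]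
  nth_rw 2 [← Real.sq_sqrt hg.le]
  field_simp

lemma divDensity_inl (I : ν) (β : Fin 2) :
    divDensity (kkMetric g A G) (raisedCurl (kkMetric g A G) (Sum.inr I)) z (Sum.inl β)
      = -(1 / 2) * ((fun k => pd k (kkTwist g A G I) (baseCoord (Fin 2) ν z)) ᵥ* areaMatrix) β := by
  have hT := H.differentiableAt_kkTwist I
  have hTz : DifferentiableAt ℝ (fun w => kkTwist g A G I (baseCoord (Fin 2) ν w)) z :=
    hT.comp z (baseCoord (Fin 2) ν).differentiableAt
  have density : ∀ γ, (fun w => √(kkMetric g A G w).det *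
      raisedCurl (kkMetric g A G) (Sum.inr I) w (Sum.inl γ) (Sum.inl β)) =ᶠ[𝓝 z]
      fun w => (-(1 / 2) * areaMatrix γ β) * kkTwist g A G I (baseCoord (Fin 2) ν w) := by
    intro γ
    filter_upwards [H.eventually_comp_baseCoord] with w hw
    have entry := congrFun (congrFun (hw.sqrt_det_smul_raisedCurl I) γ) β
    rw [Matrix.smul_apply, Matrix.smul_apply, smul_eq_mul, smul_eq_mul] at entry
    rw [mul_right_comm, ← entry, toBlocks₁₁, of_apply]
  rw [divDensity_inl_kkMetric, vecMul, dotProduct, Finset.mul_sum]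
  refine Finset.sum_congr rfl fun γ _ => ?_
  rw [pd_congr (density γ), pd_const_mul _ _ hTz, pd_inl_comp_baseCoord hT]
  ring

theorem mixedRicci_iff_pd_kkTwist (I : ν) :
    (∀ α, ricci (kkMetric g A G) (Sum.inr I) (Sum.inl α) z
      - ∑ J, A (baseCoord (Fin 2) ν z) J α *
        ricci (kkMetric g A G) (Sum.inr I) (Sum.inr J) z = 0) ↔
    ∀ k, pd k (kkTwist g A G I) (baseCoord (Fin 2) ν z) = 0 := by
  set R : Fin 2 ⊕ ν → ℝ := fun j => ricci (kkMetric g A G) (Sum.inr I) j z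
  set D := divDensity (kkMetric g A G) (raisedCurl (kkMetric g A G) (Sum.inr I)) z
  set T : Fin 2 → ℝ := fun k => pd k (kkTwist g A G I) (baseCoord (Fin 2) ν z)
  set S := coframe (-A (baseCoord (Fin 2) ν z))
  have hdet : √(kkMetric g A G z).det ≠ 0 := (Real.sqrt_pos.2 H.det_kkMetric_pos).ne'
  have hDh : √(kkMetric g A G z).det • R = D ᵥ* kkMetric g A G z := by
    ext j
    exact (H.isKillingCoord I).sqrt_det_mul_ricci j
  have hD : (fun β => D (Sum.inl β)) = -(1 / 2 : ℝ) • (T ᵥ* areaMatrix) :=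
    funext (H.divDensity_inl I)
  have horizontal : (fun α => √(kkMetric g A G z).det * (R ᵥ* S) (Sum.inl α))
      = -(1 / 2 : ℝ) • (T ᵥ* (areaMatrix * g (baseCoord (Fin 2) ν z))) := by
    ext α
    rw [← vecMul_vecMul, ← smul_vecMul, ← hD, ← smul_eq_mul, ← Pi.smul_apply, ← smul_vecMul, hDh,
      vecMul_vecMul, kkMetric, kkMatrix_mul_coframe_neg]
    simp [vecMul, dotProduct]
  have hunit : IsUnit (areaMatrix * g (baseCoord (Fin 2) ν z)) := by
    rw [isUnit_iff_isUnit_det, det_mul, isUnit_iff_ne_zero]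
    simpa [areaMatrix, det_fin_two] using H.det_g_pos.ne'
  calc _ ↔ (fun α => √(kkMetric g A G z).det * (R ᵥ* S) (Sum.inl α)) = 0 := by
        simp only [funext_iff, S, vecMul_coframe_neg_inl, Pi.zero_apply, mul_eq_zero, hdet,
          false_or, R]
    _ ↔ T = 0 := by
        rw [horizontal, smul_eq_zero_iff_right (by norm_num)]
        exact (vecMul_injective_iff_isUnit.2 hunit).eq_iff' (zero_vecMul _)
    _ ↔ _ := funext_iff

end IsKaluzaKleinAt

end Surface

/-! ### Metrics in coordinates, local inverses and homomorphisms -/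

section CoordMetric

open Matrix

variable {m : ℕ} {M : Type*} [TopologicalSpace M] [ChartedSpace (EuclideanSpace ℝ (Fin m)) M]
  [IsManifold (𝓡 m) ∞ M] {κ : Type*} [Fintype κ] {gbar : SmoothMetric m M}
  {ψ : (κ → ℝ) → M} {z : κ → ℝ}

/-- The pullback of the Riemannian metric `gbar` by `ψ` at the point `z`, as a bilinear form. -/
noncomputable def pullbackForm (gbar : SmoothMetric m M) (ψ : (κ → ℝ) → M) (z : κ → ℝ) :
    LinearMap.BilinForm ℝ (κ → ℝ) :=
  (gbar.inner (ψ z)).toLinearMap₁₂.compl₁₂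
    (mfderiv 𝓘(ℝ, κ → ℝ) (𝓡 m) ψ z).toLinearMap (mfderiv 𝓘(ℝ, κ → ℝ) (𝓡 m) ψ z).toLinearMap

lemma pullbackForm_apply (a b : κ → ℝ) :
    pullbackForm gbar ψ z a b = gbar.inner (ψ z) (mfderiv 𝓘(ℝ, κ → ℝ) (𝓡 m) ψ z a)
      (mfderiv 𝓘(ℝ, κ → ℝ) (𝓡 m) ψ z b) :=
  rfl

lemma pullbackForm_comp {κ' : Type*} [Fintype κ'] {ψ' : (κ' → ℝ) → M} {z' : κ' → ℝ}
    {θ : (κ' → ℝ) → κ → ℝ} {θ' : (κ' → ℝ) →L[ℝ] (κ → ℝ)} {Φ : M → M}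
    (h : ψ' =ᶠ[𝓝 z'] Φ ∘ ψ ∘ θ) (hθ : HasFDerivAt θ θ' z')
    (hψ : MDifferentiableAt 𝓘(ℝ, κ → ℝ) (𝓡 m) ψ (θ z'))
    (hΦ : MDifferentiableAt (𝓡 m) (𝓡 m) Φ (ψ (θ z')))
    (isometry : ∀ u v : TangentSpace (𝓡 m) (ψ (θ z')), gbar.inner (Φ (ψ (θ z')))
      (mfderiv (𝓡 m) (𝓡 m) Φ (ψ (θ z')) u) (mfderiv (𝓡 m) (𝓡 m) Φ (ψ (θ z')) v)
      = gbar.inner (ψ (θ z')) u v) :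
    pullbackForm gbar ψ' z' = (pullbackForm gbar ψ (θ z')).compl₁₂ θ'.toLinearMap
      θ'.toLinearMap := by
  have hd : HasMFDerivAt 𝓘(ℝ, κ' → ℝ) (𝓡 m) ψ' z'
      ((mfderiv (𝓡 m) (𝓡 m) Φ (ψ (θ z'))).comp
        ((mfderiv 𝓘(ℝ, κ → ℝ) (𝓡 m) ψ (θ z')).comp θ')) :=
    (hΦ.hasMFDerivAt.comp z' (hψ.hasMFDerivAt.comp z' hθ.hasMFDerivAt)).congr_of_eventuallyEq h
  refine LinearMap.ext₂ fun a b => ?_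
  rw [pullbackForm_apply, hd.mfderiv, h.self_of_nhds]
  exact isometry _ _

lemma contMDiffAt_mfderiv_apply {U : Set (κ → ℝ)} (hU : IsOpen U)
    (hψ : ContMDiffOn 𝓘(ℝ, κ → ℝ) (𝓡 m) ∞ ψ U) (hz : z ∈ U) (v : κ → ℝ) :
    ContMDiffAt 𝓘(ℝ, κ → ℝ) ((𝓡 m).tangent) ∞ (fun w =>
      Bundle.TotalSpace.mk' (EuclideanSpace ℝ (Fin m)) (E := fun p : M => TangentSpace (𝓡 m) p)
        (ψ w) (mfderiv 𝓘(ℝ, κ → ℝ) (𝓡 m) ψ w v)) z := by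
  have hdψ := hψ.contMDiffOn_tangentMapWithin (m := ∞) (by simp) hU.uniqueMDiffOn
  have hv : ContMDiff 𝓘(ℝ, κ → ℝ) (𝓘(ℝ, κ → ℝ).tangent) ∞
      (fun w : κ → ℝ => (⟨w, v⟩ : TangentBundle 𝓘(ℝ, κ → ℝ) (κ → ℝ))) :=
    contMDiff_vectorSpace_iff_contDiff.2 contDiff_const
  refine ((hdψ.comp (hv.contMDiffOn (s := U)) fun w hw => hw).contMDiffAt
    (hU.mem_nhds hz)).congr_of_eventuallyEq ?_
  filter_upwards [hU.mem_nhds hz] with w hw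
  simp only [Function.comp, tangentMapWithin, mfderivWithin_of_isOpen hU hw]

variable [DecidableEq κ]

lemma coordMetric_eq_toMatrix₂' :
    coordMetric gbar ψ z = LinearMap.toMatrix₂' ℝ (pullbackForm gbar ψ z) :=
  rfl

lemma dotProduct_coordMetric_mulVec (a b : κ → ℝ) :
    a ⬝ᵥ coordMetric gbar ψ z *ᵥ b = pullbackForm gbar ψ z a b := by
  rw [← toLinearMap₂'_apply', coordMetric_eq_toMatrix₂', toLinearMap₂'_toMatrix']

lemma posDef_coordMetric (hψ : Function.Injective (mfderiv 𝓘(ℝ, κ → ℝ) (𝓡 m) ψ z)) :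
    (coordMetric gbar ψ z).PosDef := by
  refine PosDef.of_dotProduct_mulVec_pos ?_ fun a ha => ?_
  · ext i j
    simp [coordMetric, gbar.symm]
  · rw [star_trivial, dotProduct_coordMetric_mulVec]
    exact gbar.pos _ _ fun h => ha (hψ (h.trans (map_zero _).symm))

lemma coordMetric_eq_transpose_mul_mul {κ' : Type*} [Fintype κ'] [DecidableEq κ']
    {ψ' : (κ' → ℝ) → M} {z' : κ' → ℝ} {w : κ → ℝ} {θ' : (κ' → ℝ) →L[ℝ] (κ → ℝ)}
    (h : pullbackForm gbar ψ' z' = (pullbackForm gbar ψ w).compl₁₂ θ'.toLinearMap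
      θ'.toLinearMap) :
    coordMetric gbar ψ' z' = (LinearMap.toMatrix' θ'.toLinearMap)ᵀ * coordMetric gbar ψ w *
      LinearMap.toMatrix' θ'.toLinearMap := by
  rw [coordMetric_eq_toMatrix₂', h, LinearMap.toMatrix₂'_compl₁₂, coordMetric_eq_toMatrix₂']

lemma contDiffAt_coordMetric {U : Set (κ → ℝ)} (hU : IsOpen U)
    (hψ : ContMDiffOn 𝓘(ℝ, κ → ℝ) (𝓡 m) ∞ ψ U) (hz : z ∈ U) (k l : κ) :
    ContDiffAt ℝ ∞ (fun w => coordMetric gbar ψ w k l) z := by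
  have hg := gbar.contMDiff.contMDiffAt.comp z (hψ.contMDiffAt (hU.mem_nhds hz))
  have h := ContMDiffAt.clm_bundle_apply₂ (F₁ := EuclideanSpace ℝ (Fin m))
    (F₂ := EuclideanSpace ℝ (Fin m)) (F₃ := ℝ) (E₃ := Bundle.Trivial M ℝ) (b := ψ) hg
    (contMDiffAt_mfderiv_apply hU hψ hz (Pi.single k 1))
    (contMDiffAt_mfderiv_apply hU hψ hz (Pi.single l 1))
  simp only [Bundle.contMDiffAt_totalSpace] at h
  exact h.2.contDiffAt

end CoordMetric

section LocalInverse

variable {E F : Type*} [NormedAddCommGroup E] [NormedSpace ℝ E] [NormedAddCommGroup F]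
  [NormedSpace ℝ F] {Q : Type*} [TopologicalSpace Q] [ChartedSpace F Q]

lemma hasFDerivAt_extChartAt_comp {f : E → Q} {a : E} {f' : E →L[ℝ] F}
    (hf : HasMFDerivAt 𝓘(ℝ, E) 𝓘(ℝ, F) f a f') :
    HasFDerivAt (extChartAt 𝓘(ℝ, F) (f a) ∘ f) f' a := by
  have h := hf.2
  simp only [writtenInExtChartAt, mfld_simps] at h
  exact hasFDerivWithinAt_univ.1 h

lemma exists_local_inverse [CompleteSpace E] [IsManifold 𝓘(ℝ, F) ∞ Q] {f : E → Q} {a : E}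
    (hf : ContMDiffAt 𝓘(ℝ, E) 𝓘(ℝ, F) ∞ f a) (e : E ≃L[ℝ] F)
    (he : HasMFDerivAt 𝓘(ℝ, E) 𝓘(ℝ, F) f a (e : E →L[ℝ] F)) :
    ∃ l : Q → E, ContMDiffAt 𝓘(ℝ, F) 𝓘(ℝ, E) ∞ l (f a) ∧ l (f a) = a ∧
      (∀ᶠ v in 𝓝 a, l (f v) = v) ∧ ∀ᶠ x in 𝓝 (f a), f (l x) = x := by
  have hinf : (∞ : WithTop ℕ∞) ≠ 0 := by simp
  set φ := extChartAt 𝓘(ℝ, F) (f a)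
  have hφ : ContMDiffAt 𝓘(ℝ, F) 𝓘(ℝ, F) ∞ φ (f a) := contMDiffAt_extChartAt
  have smooth : ContDiffAt ℝ ∞ (φ ∘ f) a := (hφ.comp a hf).contDiffAt
  have deriv := hasFDerivAt_extChartAt_comp he
  set l := smooth.localInverse deriv hinf ∘ φ
  have strict := smooth.hasStrictFDerivAt' deriv hinf
  have hla : l (f a) = a := smooth.localInverse_apply_image deriv hinf
  have hl : ContMDiffAt 𝓘(ℝ, F) 𝓘(ℝ, E) ∞ l (f a) :=
    (smooth.to_localInverse deriv hinf).contMDiffAt.comp (f a) hφ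
  have hfl : ContinuousAt (f ∘ l) (f a) :=
    ContinuousAt.comp (by rw [hla]; exact hf.continuousAt) hl.continuousAt
  have hφl : ∀ᶠ x in 𝓝 (f a), φ (f (l x)) = φ x :=
    hφ.continuousAt.eventually strict.eventually_right_inverse
  have hsource : ∀ᶠ x in 𝓝 (f a), f (l x) ∈ φ.source :=
    hfl.eventually_mem (by
      simpa only [Function.comp, hla] using extChartAt_source_mem_nhds (I := 𝓘(ℝ, F)) _)
  refine ⟨l, hl, hla, strict.eventually_left_inverse, ?_⟩
  filter_upwards [hφl, hsource, extChartAt_source_mem_nhds (I := 𝓘(ℝ, F)) (f a)] with x h1 h2 h3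
  exact φ.injOn h2 h3 h1

lemma hasMFDerivAt_comp_zero {F' Q' : Type*} [NormedAddCommGroup F'] [NormedSpace ℝ F']
    [TopologicalSpace Q'] [ChartedSpace F' Q'] {f : E → Q} {g : Q → Q'} {a : E}
    (hg : MDifferentiableAt 𝓘(ℝ, F) 𝓘(ℝ, F') g (f a))
    (hf : HasMFDerivAt 𝓘(ℝ, E) 𝓘(ℝ, F) f a (0 : E →L[ℝ] F)) :
    HasMFDerivAt 𝓘(ℝ, E) 𝓘(ℝ, F') (g ∘ f) a (0 : E →L[ℝ] F') :=
  (hg.hasMFDerivAt.comp a hf).congr_mfderiv (ContinuousLinearMap.comp_zero (M₃ := F') _)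

lemma mfderiv_injective_of_left_inverse {ψ : E → Q} {R : Q → E} {z : E}
    (hψ : MDifferentiableAt 𝓘(ℝ, E) 𝓘(ℝ, F) ψ z)
    (hR : MDifferentiableAt 𝓘(ℝ, F) 𝓘(ℝ, E) R (ψ z)) (h : ∀ᶠ w in 𝓝 z, R (ψ w) = w) :
    Function.Injective (mfderiv 𝓘(ℝ, E) 𝓘(ℝ, F) ψ z) := by
  have hRψ := (hR.hasMFDerivAt.comp z hψ.hasMFDerivAt).congr_of_eventuallyEq
    (f₁ := id) (h.mono fun w hw => hw.symm)
  have hid := hasMFDerivAt_unique hRψ (hasMFDerivAt_id z)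
  exact Function.LeftInverse.injective (g := mfderiv 𝓘(ℝ, F) 𝓘(ℝ, E) R (ψ z))
    fun w => congrArg (fun L => L w) hid

lemma isLocallyConstant_of_hasMFDerivAt_zero [IsManifold 𝓘(ℝ, F) 1 Q] {f : E → Q}
    (hf : ∀ v, HasMFDerivAt 𝓘(ℝ, E) 𝓘(ℝ, F) f v (0 : E →L[ℝ] F)) : IsLocallyConstant f := by
  refine (IsLocallyConstant.iff_eventually_eq f).2 fun a => ?_
  set φ := extChartAt 𝓘(ℝ, F) (f a)
  obtain ⟨ε, hε, hball⟩ := Metric.mem_nhds_iff.1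
    ((hf a).continuousAt.preimage_mem_nhds (extChartAt_source_mem_nhds (I := 𝓘(ℝ, F)) (f a)))
  have deriv : ∀ w ∈ Metric.ball a ε, HasFDerivAt (φ ∘ f) (0 : E →L[ℝ] F) w := fun w hw => by
    have hφ : MDifferentiableAt 𝓘(ℝ, F) 𝓘(ℝ, F) φ (f w) :=
      mdifferentiableAt_extChartAt (by simpa [φ] using hball hw)
    exact (hasMFDerivAt_comp_zero hφ (hf w)).hasFDerivAt
  filter_upwards [Metric.ball_mem_nhds a hε] with v hv
  refine φ.injOn (hball hv) (hball (Metric.mem_ball_self hε)) ?_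
  exact (convex_ball a ε).is_const_of_fderivWithin_eq_zero (𝕜 := ℝ) (f := φ ∘ f)
    (fun w hw => (deriv w hw).differentiableAt.differentiableWithinAt)
    (fun w hw => (deriv w hw).hasFDerivWithinAt.fderivWithin
      (Metric.isOpen_ball.uniqueDiffWithinAt hw)) hv (Metric.mem_ball_self hε)

end LocalInverse

section Homomorphisms

variable {E F 𝒢 : Type*} [NormedAddCommGroup E] [NormedSpace ℝ E] [NormedAddCommGroup F]
  [NormedSpace ℝ F] [AddCommGroup 𝒢] [TopologicalSpace 𝒢] [ChartedSpace F 𝒢]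
  [LieAddGroup 𝓘(ℝ, F) ∞ 𝒢]

lemma hasMFDerivAt_zero_of_addMonoidHom {r : E →+ 𝒢}
    (h : HasMFDerivAt 𝓘(ℝ, E) 𝓘(ℝ, F) r 0 (0 : E →L[ℝ] F)) (v : E) :
    HasMFDerivAt 𝓘(ℝ, E) 𝓘(ℝ, F) r v (0 : E →L[ℝ] F) := by
  have translate : (r : E → 𝒢) = (fun x : 𝒢 => r v + x) ∘ r ∘ (fun w : E => w - v) := by
    ext w
    simp
  have hsub : HasMFDerivAt 𝓘(ℝ, E) 𝓘(ℝ, E) (fun w : E => w - v) v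
      (ContinuousLinearMap.id ℝ E) := ((hasFDerivAt_id v).sub_const v).hasMFDerivAt
  have hadd : ContMDiff 𝓘(ℝ, F) 𝓘(ℝ, F) ∞ (fun x : 𝒢 => r v + x) := contMDiff_add_left
  rw [← sub_self v] at h
  rw [translate]
  exact hasMFDerivAt_comp_zero (hadd.mdifferentiableAt (by simp))
    (HasMFDerivAt.comp (f := fun w : E => w - v) v h hsub)

lemma mfderiv_sub_diag_eq_zero {x : 𝒢 × 𝒢} (hx : x.1 = x.2) (v : F) :
    mfderiv (𝓘(ℝ, F).prod 𝓘(ℝ, F)) 𝓘(ℝ, F) (fun x : 𝒢 × 𝒢 => x.1 - x.2) x (v, v) = 0 := by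
  obtain ⟨q, q'⟩ := x
  obtain rfl : q = q' := hx
  have hs : ContMDiff (𝓘(ℝ, F).prod 𝓘(ℝ, F)) 𝓘(ℝ, F) ∞ (fun x : 𝒢 × 𝒢 => x.1 - x.2) :=
    contMDiff_fst.sub contMDiff_snd
  have diag := (hs.mdifferentiableAt (x := (q, q)) (by simp)).hasMFDerivAt.comp q
    (f := fun w => (id w, id w)) ((hasMFDerivAt_id q).prodMk (hasMFDerivAt_id q))
  have hzero := hasMFDerivAt_unique diag
    ((hasMFDerivAt_const (0 : 𝒢) q).congr_of_eventuallyEq (.of_forall fun w => sub_self w))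
  exact congrArg (fun L => L v) hzero

lemma hasMFDerivAt_sub_zero {f₁ f₂ : E → 𝒢} {a : E} {f' : E →L[ℝ] F}
    (h₁ : HasMFDerivAt 𝓘(ℝ, E) 𝓘(ℝ, F) f₁ a f') (h₂ : HasMFDerivAt 𝓘(ℝ, E) 𝓘(ℝ, F) f₂ a f')
    (ha : f₁ a = f₂ a) :
    HasMFDerivAt 𝓘(ℝ, E) 𝓘(ℝ, F) (fun v => f₁ v - f₂ v) a (0 : E →L[ℝ] F) := by
  have hs : ContMDiff (𝓘(ℝ, F).prod 𝓘(ℝ, F)) 𝓘(ℝ, F) ∞ (fun x : 𝒢 × 𝒢 => x.1 - x.2) :=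
    contMDiff_fst.sub contMDiff_snd
  have h := (hs.mdifferentiableAt (x := (f₁ a, f₂ a)) (by simp)).hasMFDerivAt.comp a
    (h₁.prodMk h₂)
  exact h.congr_mfderiv (ContinuousLinearMap.ext fun v => mfderiv_sub_diag_eq_zero ha (f' v))

theorem addMonoidHom_eq_of_hasMFDerivAt {p q : E →+ 𝒢} {f' : E →L[ℝ] F}
    (hp : HasMFDerivAt 𝓘(ℝ, E) 𝓘(ℝ, F) p 0 f') (hq : HasMFDerivAt 𝓘(ℝ, E) 𝓘(ℝ, F) q 0 f') :
    p = q := by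
  have : IsManifold 𝓘(ℝ, F) ∞ 𝒢 := inferInstance
  have : IsManifold 𝓘(ℝ, F) 1 𝒢 := .of_le (n := ∞) (by simp)
  have hd : HasMFDerivAt 𝓘(ℝ, E) 𝓘(ℝ, F) (p - q) 0 (0 : E →L[ℝ] F) :=
    hasMFDerivAt_sub_zero hp hq (by simp)
  have hconst := isLocallyConstant_of_hasMFDerivAt_zero (hasMFDerivAt_zero_of_addMonoidHom hd)
  refine sub_eq_zero.1 (AddMonoidHom.ext fun v => ?_)
  rw [hconst.apply_eq_of_preconnectedSpace v 0, map_zero, AddMonoidHom.zero_apply]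

end Homomorphisms

/-! ### Adapted coordinates -/

section Blocks

open Matrix

lemma isSymm_of_posDef {κ : Type*} {h : Matrix κ κ ℝ} (hh : h.PosDef) : h.IsSymm :=
  isHermitian_iff_isSymm.1 hh.isHermitian

variable {μ ν : Type*} [Fintype μ] [DecidableEq μ] [Fintype ν] [DecidableEq ν]

lemma kkMatrix_toBlocks {m : Matrix (μ ⊕ ν) (μ ⊕ ν) ℝ} (hm : m.IsSymm)
    (hG : IsUnit m.toBlocks₂₂.det) :
    kkMatrix (m.toBlocks₁₁ - (m.toBlocks₂₂⁻¹ * m.toBlocks₂₁)ᵀ * m.toBlocks₂₂ *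
      (m.toBlocks₂₂⁻¹ * m.toBlocks₂₁)) (m.toBlocks₂₂⁻¹ * m.toBlocks₂₁) m.toBlocks₂₂ = m := by
  have symm₂₁ : m.toBlocks₂₁ᵀ = m.toBlocks₁₂ := Matrix.ext fun _ _ => hm.apply _ _
  have symm₂₂ : m.toBlocks₂₂ᵀ = m.toBlocks₂₂ := Matrix.ext fun _ _ => hm.apply _ _
  have lower : m.toBlocks₂₂ * (m.toBlocks₂₂⁻¹ * m.toBlocks₂₁) = m.toBlocks₂₁ :=
    mul_nonsing_inv_cancel_left _ _ hG
  have upper : (m.toBlocks₂₂⁻¹ * m.toBlocks₂₁)ᵀ * m.toBlocks₂₂ = m.toBlocks₁₂ := by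
    rw [transpose_mul, symm₂₁, transpose_nonsing_inv, symm₂₂, nonsing_inv_mul_cancel_right _ _ hG]
  rw [kkMatrix_eq_fromBlocks, lower, upper, sub_add_cancel, fromBlocks_toBlocks]

end Blocks

/-- The linear fiber coordinates, as a vector of the Lie algebra `ℝ^N`. -/
noncomputable def fiberCoord (μ ν : Type*) [Fintype ν] : (μ ⊕ ν → ℝ) →L[ℝ] EuclideanSpace ℝ ν :=
  (EuclideanSpace.equiv ν ℝ).symm.toContinuousLinearMap ∘L
    ContinuousLinearMap.pi fun I => ContinuousLinearMap.proj (Sum.inr I)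

namespace TwistedBundle

section Trivialization

variable {ι : Type*} {n N : ℕ} {B 𝒢 M : Type*}
  [TopologicalSpace B] [ChartedSpace (EuclideanSpace ℝ (Fin n)) B]
  [AddCommGroup 𝒢] [TopologicalSpace 𝒢] [ChartedSpace (EuclideanSpace ℝ (Fin N)) 𝒢]
  [TopologicalSpace M] [ChartedSpace (EuclideanSpace ℝ (Fin (n + N))) M]
  {P : TwistedBundle ι n N B 𝒢 M} {i : ι}

lemma contMDiffAt_triv {p : M} (hp : p ∈ (P.triv i).source) :
    ContMDiffAt (𝓡 (n + N)) ((𝓡 n).prod (𝓡 N)) ∞ (P.triv i) p :=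
  (P.contMDiffOn_triv i).contMDiffAt ((P.triv i).open_source.mem_nhds hp)

variable {b : B} (hb : b ∈ (P.triv i).baseSet) (x : 𝒢)
include hb

lemma contMDiffAt_triv_symm :
    ContMDiffAt ((𝓡 n).prod (𝓡 N)) (𝓡 (n + N)) ∞
      (P.triv i).toOpenPartialHomeomorph.symm (b, x) :=
  (P.contMDiffOn_triv_symm i).contMDiffAt
    ((P.triv i).open_target.mem_nhds ((P.triv i).mem_target.2 hb))

lemma triv_symm_mem_source :
    (P.triv i).toOpenPartialHomeomorph.symm (b, x) ∈ (P.triv i).source :=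
  (P.triv i).toOpenPartialHomeomorph.map_target ((P.triv i).mem_target.2 hb)

lemma act_triv_symm (c : 𝒢) :
    P.act i c ((P.triv i).toOpenPartialHomeomorph.symm (b, x))
      = (P.triv i).toOpenPartialHomeomorph.symm (b, x + c) := by
  rw [act, (P.triv i).apply_symm_apply' hb]

end Trivialization

section Act

variable {ι : Type*} {n N : ℕ} {B 𝒢 M : Type*}
  [TopologicalSpace B] [ChartedSpace (EuclideanSpace ℝ (Fin n)) B]
  [AddCommGroup 𝒢] [TopologicalSpace 𝒢] [ChartedSpace (EuclideanSpace ℝ (Fin N)) 𝒢]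
  [TopologicalSpace M] [ChartedSpace (EuclideanSpace ℝ (Fin (n + N))) M]
  {P : TwistedBundle ι n N B 𝒢 M}

lemma mdifferentiableAt_act [LieAddGroup (𝓡 N) ∞ 𝒢] {i : ι} (c : 𝒢) {p : M}
    (hp : p ∈ (P.triv i).source) :
    MDifferentiableAt (𝓡 (n + N)) (𝓡 (n + N)) (P.act i c) p := by
  have htriv := contMDiffAt_triv hp
  have hb : (P.triv i p).1 ∈ (P.triv i).baseSet := by
    rw [(P.triv i).coe_fst hp]
    exact (P.triv i).mem_source.1 hp
  have translate : ContMDiffAt (𝓡 (n + N)) ((𝓡 n).prod (𝓡 N)) ∞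
      (fun p => ((P.triv i p).1, (P.triv i p).2 + c)) p :=
    htriv.fst.prodMk (htriv.snd.add contMDiffAt_const)
  exact ((contMDiffAt_triv_symm hb _).comp p translate).mdifferentiableAt (by simp)

namespace AdaptedCoords

variable [IsManifold (𝓡 n) ∞ B] (C : P.AdaptedCoords)

lemma isOpen_domain : IsOpen C.domain := by
  have h : IsOpen (C.chart.target ∩ C.chart.symm ⁻¹' (P.triv C.idx).baseSet) :=
    C.chart.continuousOn_symm.isOpen_inter_preimage C.chart.open_target (P.triv C.idx).open_baseSet
  exact h.preimage (PiLp.continuous_toLp 2 _)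

section Point

variable {C} {y : Fin n → ℝ} (hy : y ∈ C.domain)
include hy

lemma contMDiffAt_point : ContMDiffAt 𝓘(ℝ, Fin n → ℝ) (𝓡 n) ∞ C.point y :=
  (contMDiffAt_symm_of_mem_maximalAtlas C.chart_mem hy.1).comp y
    (PiLp.contDiff_toLp (p := 2)).contMDiff.contMDiffAt

lemma chart_point : C.chart (C.point y) = WithLp.toLp 2 y :=
  C.chart.right_inv hy.1

lemma point_mem_source : C.point y ∈ C.chart.source :=
  C.chart.map_target hy.1

end Point

lemma hasMFDerivAt_lin_zero :
    HasMFDerivAt (𝓡 N) (𝓡 N) C.lin 0 (ContinuousLinearMap.id ℝ (EuclideanSpace ℝ (Fin N))) := by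
  rw [← show mfderiv (𝓡 N) (𝓡 N) C.lin 0 = ContinuousLinearMap.id ℝ (EuclideanSpace ℝ (Fin N)) from
    ContinuousLinearMap.ext C.mfderiv_lin]
  exact (C.contMDiff_lin.mdifferentiableAt (by simp)).hasMFDerivAt

lemma exists_lin_inverse [LieAddGroup (𝓡 N) ∞ 𝒢] (v : EuclideanSpace ℝ (Fin N)) :
    ∃ l : 𝒢 → EuclideanSpace ℝ (Fin N), ContMDiffAt (𝓡 N) (𝓡 N) ∞ l (C.lin v) ∧
      l (C.lin v) = v ∧ (∀ᶠ w in 𝓝 v, l (C.lin w) = w) ∧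
      ∀ᶠ x in 𝓝 (C.lin v), C.lin (l x) = x := by
  have : IsManifold (𝓡 N) ∞ 𝒢 := inferInstance
  obtain ⟨l, hl, hl_zero, hl_left, hl_right⟩ := exists_local_inverse C.contMDiff_lin.contMDiffAt
    (ContinuousLinearEquiv.refl ℝ _) C.hasMFDerivAt_lin_zero
  rw [map_zero] at hl hl_zero hl_right
  have hsub : ContMDiffAt (𝓡 N) (𝓡 N) ∞ (fun x => x - C.lin v) (C.lin v) :=
    contMDiffAt_id.sub contMDiffAt_const
  have to_zero : Filter.Tendsto (fun x => x - C.lin v) (𝓝 (C.lin v)) (𝓝 0) :=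
    sub_self (C.lin v) ▸ hsub.continuousAt.tendsto
  have to_zero' : Filter.Tendsto (fun w => w - v) (𝓝 v) (𝓝 0) :=
    sub_self v ▸ (continuousAt_id.sub continuousAt_const).tendsto
  refine ⟨fun x => l (x - C.lin v) + v, ?_, by simp [hl_zero], ?_, ?_⟩
  · exact (ContMDiffAt.comp (C.lin v) (g := l) (by rwa [sub_self]) hsub).add contMDiffAt_const
  · filter_upwards [to_zero'.eventually hl_left] with w hw
    rw [← map_sub, hw, sub_add_cancel]
  · filter_upwards [to_zero.eventually hl_right] with x hx
    rw [map_add, hx, sub_add_cancel]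

/-- The domain of the local parametrization `param`. -/
def paramDomain : Set (Fin n ⊕ Fin N → ℝ) :=
  baseCoord (Fin n) (Fin N) ⁻¹' C.domain

lemma isOpen_paramDomain : IsOpen C.paramDomain :=
  C.isOpen_domain.preimage (baseCoord (Fin n) (Fin N)).continuous

lemma param_eq (z : Fin n ⊕ Fin N → ℝ) :
    C.param z = (P.triv C.idx).toOpenPartialHomeomorph.symm
      (C.point (baseCoord (Fin n) (Fin N) z), C.lin (fiberCoord (Fin n) (Fin N) z)) :=
  rfl

section Param

variable {C} {z : Fin n ⊕ Fin N → ℝ} (hz : z ∈ C.paramDomain)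
include hz

lemma contMDiffAt_param :
    ContMDiffAt 𝓘(ℝ, Fin n ⊕ Fin N → ℝ) (𝓡 (n + N)) ∞ C.param z := by
  have base := (contMDiffAt_point hz).comp z
    (baseCoord (Fin n) (Fin N)).contDiff.contMDiff.contMDiffAt
  have fiber := C.contMDiff_lin.contMDiffAt.comp z
    (fiberCoord (Fin n) (Fin N)).contDiff.contMDiff.contMDiffAt
  exact (contMDiffAt_triv_symm hz.2 _).comp z (base.prodMk fiber)

lemma param_mem_source : C.param z ∈ (P.triv C.idx).source :=
  triv_symm_mem_source hz.2 _

lemma mdifferentiableAt_param :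
    MDifferentiableAt 𝓘(ℝ, Fin n ⊕ Fin N → ℝ) (𝓡 (n + N)) C.param z :=
  (contMDiffAt_param hz).mdifferentiableAt (by simp)

lemma triv_param : P.triv C.idx (C.param z)
    = (C.point (baseCoord (Fin n) (Fin N) z), C.lin (fiberCoord (Fin n) (Fin N) z)) :=
  (P.triv C.idx).apply_symm_apply' hz.2

lemma exists_param_left_inverse [LieAddGroup (𝓡 N) ∞ 𝒢] : ∃ R : M → Fin n ⊕ Fin N → ℝ,
    ContMDiffAt (𝓡 (n + N)) 𝓘(ℝ, Fin n ⊕ Fin N → ℝ) ∞ R (C.param z) ∧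
      ∀ᶠ w in 𝓝 z, R (C.param w) = w := by
  obtain ⟨l, hl, -, hl_left, -⟩ := C.exists_lin_inverse (fiberCoord (Fin n) (Fin N) z)
  have htriv := contMDiffAt_triv (param_mem_source hz)
  refine ⟨fun p => Sum.elim (WithLp.ofLp (C.chart (P.triv C.idx p).1))
    (WithLp.ofLp (l (P.triv C.idx p).2)), contMDiffAt_pi_space.2 ?_, ?_⟩
  · have base := (PiLp.contDiff_ofLp (p := 2)).contMDiff.contMDiffAt.comp (C.param z)
      (ContMDiffAt.comp (C.param z) (g := C.chart) (by
        rw [triv_param hz]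
        exact contMDiffAt_of_mem_maximalAtlas C.chart_mem (point_mem_source hz)) htriv.fst)
    have fiber := (PiLp.contDiff_ofLp (p := 2)).contMDiff.contMDiffAt.comp (C.param z)
      (ContMDiffAt.comp (C.param z) (g := l) (by rwa [triv_param hz]) htriv.snd)
    rintro (α | I)
    · exact contMDiffAt_pi_space.1 base α
    · exact contMDiffAt_pi_space.1 fiber I
  · filter_upwards [C.isOpen_paramDomain.mem_nhds hz,
      (fiberCoord (Fin n) (Fin N)).continuous.continuousAt.eventually hl_left] with w hw hlw
    rw [triv_param hw, chart_point hw, hlw]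
    ext (α | I) <;> rfl

lemma mfderiv_param_injective [LieAddGroup (𝓡 N) ∞ 𝒢] :
    Function.Injective (mfderiv 𝓘(ℝ, Fin n ⊕ Fin N → ℝ) (𝓡 (n + N)) C.param z) := by
  obtain ⟨R, hR, hR_left⟩ := exists_param_left_inverse hz
  exact mfderiv_injective_of_left_inverse (mdifferentiableAt_param hz)
    (hR.mdifferentiableAt (by simp)) hR_left

lemma mfderiv_param_bijective [LieAddGroup (𝓡 N) ∞ 𝒢] :
    Function.Bijective (mfderiv 𝓘(ℝ, Fin n ⊕ Fin N → ℝ) (𝓡 (n + N)) C.param z) := by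
  have injective := mfderiv_param_injective hz
  let D : (Fin n ⊕ Fin N → ℝ) →ₗ[ℝ] EuclideanSpace ℝ (Fin (n + N)) :=
    (mfderiv 𝓘(ℝ, Fin n ⊕ Fin N → ℝ) (𝓡 (n + N)) C.param z).toLinearMap
  exact ⟨injective,
    (LinearMap.injective_iff_surjective_of_finrank_eq_finrank (f := D) (by simp)).1 injective⟩

end Param

lemma contMDiffOn_param :
    ContMDiffOn 𝓘(ℝ, Fin n ⊕ Fin N → ℝ) (𝓡 (n + N)) ∞ C.param C.paramDomain :=
  fun _ hz => (contMDiffAt_param hz).contMDiffWithinAt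

variable [IsManifold (𝓡 (n + N)) ∞ M]

section Metric

variable [LieAddGroup (𝓡 N) ∞ 𝒢] {C} (gbar : SmoothMetric (n + N) M) {y : Fin n → ℝ}
  (hy : y ∈ C.domain)
include hy

lemma posDef_metric : (C.metric gbar y).PosDef :=
  posDef_coordMetric (mfderiv_param_injective (z := Sum.elim y 0) hy)

lemma posDef_G : (C.G gbar y).PosDef :=
  (posDef_metric gbar hy).submatrix Sum.inr_injective

lemma metric_eq_kkMatrix :
    C.metric gbar y = kkMatrix (C.g gbar y) (C.A gbar y) (C.G gbar y) :=
  (kkMatrix_toBlocks (isSymm_of_posDef (posDef_metric gbar hy))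
    (posDef_G gbar hy).det_pos.ne'.isUnit).symm

lemma isSymm_g : (C.g gbar y).IsSymm := by
  have symm_metric : (C.metric gbar y).toBlocks₁₁.IsSymm :=
    Matrix.ext fun _ _ => (isSymm_of_posDef (posDef_metric gbar hy)).apply _ _
  rw [Matrix.IsSymm, g, Matrix.transpose_sub, symm_metric.eq]
  simp only [Matrix.transpose_mul, (isSymm_of_posDef (posDef_G gbar hy)).eq,
    Matrix.transpose_transpose, Matrix.mul_assoc]

lemma det_g_pos : 0 < (C.g gbar y).det := by
  have h := (posDef_metric gbar hy).det_pos
  rw [metric_eq_kkMatrix gbar hy, det_kkMatrix] at h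
  exact (mul_pos_iff_of_pos_right (posDef_G gbar hy).det_pos).1 h

end Metric

section MetricSmooth

variable {C} (gbar : SmoothMetric (n + N) M) {y : Fin n → ℝ} (hy : y ∈ C.domain)
include hy

lemma contDiffAt_metric (i j : Fin n ⊕ Fin N) :
    ContDiffAt ℝ ∞ (fun w => C.metric gbar w i j) y := by
  have section_smooth :
      ContDiffAt ℝ ∞ (fun w : Fin n → ℝ => (Sum.elim w 0 : Fin n ⊕ Fin N → ℝ)) y := by
    refine contDiffAt_pi.2 ?_
    rintro (α | _)
    · exact contDiffAt_apply ℝ _ α y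
    · exact contDiffAt_const
  exact ContDiffAt.comp y (contDiffAt_coordMetric C.isOpen_paramDomain C.contMDiffOn_param
    (z := Sum.elim y 0) hy i j) section_smooth

variable [LieAddGroup (𝓡 N) ∞ 𝒢]

lemma contDiffAt_A (I : Fin N) (α : Fin n) : ContDiffAt ℝ ∞ (fun w => C.A gbar w I α) y :=
  contDiffAt_matrix_mul
    (contDiffAt_matrix_inv (fun _ _ => contDiffAt_metric gbar hy _ _)
      (posDef_G gbar hy).det_pos.ne')
    (fun _ _ => contDiffAt_metric gbar hy _ _) I α

lemma contDiffAt_g (α β : Fin n) : ContDiffAt ℝ ∞ (fun w => C.g gbar w α β) y :=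
  (contDiffAt_metric gbar hy _ _).sub (contDiffAt_matrix_mul
    (contDiffAt_matrix_mul (fun _ _ => contDiffAt_A gbar hy _ _)
      fun _ _ => contDiffAt_metric gbar hy _ _)
    (fun _ _ => contDiffAt_A gbar hy _ _) α β)

lemma isKaluzaKleinAt : IsKaluzaKleinAt (C.g gbar) (C.A gbar) (C.G gbar) y where
  contDiffAt_g α β := (contDiffAt_g gbar hy α β).of_le ENat.LEInfty.out
  contDiffAt_A I α := (contDiffAt_A gbar hy I α).of_le ENat.LEInfty.out
  contDiffAt_G _ _ := (contDiffAt_metric gbar hy _ _).of_le ENat.LEInfty.out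
  isSymm_g := (C.isOpen_domain.eventually_mem hy).mono fun _ => isSymm_g gbar
  isSymm_G := (C.isOpen_domain.eventually_mem hy).mono fun _ hw =>
    isSymm_of_posDef (posDef_G gbar hw)
  det_g_pos := det_g_pos gbar hy
  det_G_pos := (posDef_G gbar hy).det_pos

end MetricSmooth

section Invariant

variable [LieAddGroup (𝓡 N) ∞ 𝒢] {C} {gbar : SmoothMetric (n + N) M} (hinv : P.IsInvariant gbar)
  {z : Fin n ⊕ Fin N → ℝ} (hz : z ∈ C.paramDomain)
include hinv hz

lemma coordMetric_param_eq_metric :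
    coordMetric gbar C.param z = C.metric gbar (baseCoord (Fin n) (Fin N) z) := by
  set x : Fin n ⊕ Fin N → ℝ := Sum.elim 0 (fun I => z (Sum.inr I)) with hx
  have base (w) : baseCoord (Fin n) (Fin N) (w - x) = baseCoord (Fin n) (Fin N) w := by
    ext α
    simp [hx, baseCoord]
  have fiber : fiberCoord (Fin n) (Fin N) x = fiberCoord (Fin n) (Fin N) z := rfl
  have hzx : z - x = Sum.elim (baseCoord (Fin n) (Fin N) z) 0 := by
    ext (α | I) <;> simp [hx, baseCoord]
  have hzx' : z - x ∈ C.paramDomain := by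
    rwa [paramDomain, Set.mem_preimage, base]
  have translate : C.param =ᶠ[𝓝 z]
      P.act C.idx (C.lin (fiberCoord (Fin n) (Fin N) z)) ∘ C.param ∘ fun w => w - x := by
    filter_upwards [C.isOpen_paramDomain.mem_nhds hz] with w hw
    rw [Function.comp_apply, Function.comp_apply, param_eq, param_eq, base, act_triv_symm hw.2,
      ← map_add, map_sub, fiber, sub_add_cancel]
  have hsource := param_mem_source hzx'
  have form := pullbackForm_comp (gbar := gbar) translate ((hasFDerivAt_id z).sub_const x)
    (mdifferentiableAt_param hzx') (mdifferentiableAt_act _ hsource) (hinv C.idx _ _ hsource)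
  rw [metric, ← hzx, coordMetric_eq_toMatrix₂', coordMetric_eq_toMatrix₂', form]
  rfl

lemma coordMetric_param_eventuallyEq :
    coordMetric gbar C.param =ᶠ[𝓝 z] kkMetric (C.g gbar) (C.A gbar) (C.G gbar) := by
  filter_upwards [C.isOpen_paramDomain.mem_nhds hz] with w hw
  rw [coordMetric_param_eq_metric hinv hw, metric_eq_kkMatrix gbar hw, kkMetric]

end Invariant

end AdaptedCoords

theorem mixedRicciEquation_of_isEinstein [LieAddGroup (𝓡 N) ∞ 𝒢] [IsManifold (𝓡 n) ∞ B]
    [IsManifold (𝓡 (n + N)) ∞ M] {gbar : SmoothMetric (n + N) M} {lam : ℝ} (h : IsEinstein gbar lam)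
    (hinv : P.IsInvariant gbar) : P.MixedRicciEquation gbar := by
  intro C y hy x I α
  set z : Fin n ⊕ Fin N → ℝ := Sum.elim y x
  set k := kkMatrix (C.g gbar y) (C.A gbar y) (C.G gbar y)
  have row (j) : ricci (coordMetric gbar C.param) (Sum.inr I) j z = (lam • k (Sum.inr I)) j := by
    have hm : coordMetric gbar C.param z = k :=
      (C.coordMetric_param_eventuallyEq hinv (z := z) hy).self_of_nhds
    rw [h (Fin n ⊕ Fin N) (by simp) C.paramDomain C.param C.isOpen_paramDomain
      C.contMDiffOn_param (fun _ hz => C.mfderiv_param_bijective hz) z hy, hm, Pi.smul_apply,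
      smul_eq_mul]
  simp only [row]
  rw [← vecMul_coframe_neg_inl, Matrix.smul_vecMul, Pi.smul_apply, ← Matrix.mul_apply_eq_vecMul,
    kkMatrix_mul_coframe_neg, Matrix.fromBlocks_apply₂₁, Matrix.zero_apply, smul_zero]

end Act

section Twist

variable {ι : Type*} {N : ℕ} {B 𝒢 M : Type*}
  [TopologicalSpace B] [ChartedSpace (EuclideanSpace ℝ (Fin 2)) B] [IsManifold (𝓡 2) ∞ B]
  [AddCommGroup 𝒢] [TopologicalSpace 𝒢] [ChartedSpace (EuclideanSpace ℝ (Fin N)) 𝒢]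
  [TopologicalSpace M] [ChartedSpace (EuclideanSpace ℝ (Fin (2 + N))) M]
  [IsManifold (𝓡 (2 + N)) ∞ M] {P : TwistedBundle ι 2 N B 𝒢 M} {gbar : SmoothMetric (2 + N) M}

lemma AdaptedCoords.twist_eq_kkTwist (C : P.AdaptedCoords) (I : Fin N) :
    C.twist gbar I = kkTwist (C.g gbar) (C.A gbar) (C.G gbar) I :=
  rfl

theorem mixedRicciEquation_iff_pd_twist [LieAddGroup (𝓡 N) ∞ 𝒢] (hinv : P.IsInvariant gbar) :
    P.MixedRicciEquation gbar ↔
      ∀ C : P.AdaptedCoords, ∀ y ∈ C.domain, ∀ I k, pd k (C.twist gbar I) y = 0 := by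
  refine forall_congr' fun C => forall₂_congr fun y hy => ?_
  have pointwise (x : Fin N → ℝ) (I : Fin N) :=
    IsKaluzaKleinAt.mixedRicci_iff_pd_kkTwist (z := Sum.elim y x)
      (AdaptedCoords.isKaluzaKleinAt gbar hy) I
  simp only [C.twist_eq_kkTwist,
    ricci_congr (AdaptedCoords.coordMetric_param_eventuallyEq hinv (z := Sum.elim y _) hy)]
  exact ⟨fun h I => (pointwise 0 I).1 (h 0 I), fun h x I => (pointwise x I).2 (h I)⟩

end Twist

end TwistedBundle

/-! ### Coordinate changes of Kaluza-Klein metrics -/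

section Jacobian

open Matrix

variable {κ κ' : Type*} [DecidableEq κ']

/-- The Jacobian matrix of a map between coordinate spaces. -/
noncomputable def jacobian (φ : (κ' → ℝ) → κ → ℝ) (y : κ' → ℝ) : Matrix κ κ' ℝ :=
  Matrix.of fun k α => pd α (fun w => φ w k) y

lemma hasFDerivAt_jacobian [Fintype κ'] [Finite κ] {φ : (κ' → ℝ) → κ → ℝ} {y : κ' → ℝ}
    (hφ : DifferentiableAt ℝ φ y) :
    HasFDerivAt φ (Matrix.toLin' (jacobian φ y)).toContinuousLinearMap y := by
  cases nonempty_fintype κ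
  refine hasFDerivAt_pi'.2 fun k => (differentiableAt_pi.1 hφ k).hasFDerivAt.congr_fderiv ?_
  refine ContinuousLinearMap.ext fun v => ?_
  simp [fderiv_apply_eq_sum_pd, jacobian, mulVec, dotProduct, mul_comm]

lemma pd_comp [Finite κ'] [Fintype κ] [DecidableEq κ] {f : (κ → ℝ) → ℝ}
    {φ : (κ' → ℝ) → κ → ℝ} {z : κ' → ℝ} (hf : DifferentiableAt ℝ f (φ z))
    (hφ : DifferentiableAt ℝ φ z) (α : κ') :
    pd α (fun w => f (φ w)) z = ∑ k, pd k f (φ z) * jacobian φ z k α := by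
  cases nonempty_fintype κ'
  have chain := (hf.hasFDerivAt.comp z (hasFDerivAt_jacobian hφ)).fderiv
  rw [pd, show (fun w => f (φ w)) = f ∘ φ from rfl, chain, ContinuousLinearMap.comp_apply,
    fderiv_apply_eq_sum_pd]
  simp [mul_comm]

lemma curvature_sum_smul [Finite κ'] {ν : Type*} [Fintype ν] {a : ν → (κ' → ℝ) → κ' → ℝ}
    {y : κ' → ℝ} (ha : ∀ K β, DifferentiableAt ℝ (fun w => a K w β) y) (c : ν → ℝ) :
    curvature (fun w β => ∑ K, c K * a K w β) y = ∑ K, c K • curvature (a K) y := by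
  ext α β
  cases nonempty_fintype κ'
  have deriv (α β) : pd α (fun w => ∑ K, c K * a K w β) y
      = ∑ K, c K * pd α (fun w => a K w β) y := by
    rw [pd_sum α fun K _ => (ha K β).const_mul _]
    exact Finset.sum_congr rfl fun K _ => pd_const_mul α _ (ha K β)
  simp [curvature, deriv, Matrix.sum_apply, mul_sub]

variable [Fintype κ']

lemma pd_comm {f : (κ' → ℝ) → ℝ} {z : κ' → ℝ} (hf : ContDiffAt ℝ 2 f z) (α β : κ') :
    pd α (pd β f) z = pd β (pd α f) z := by
  have hd : DifferentiableAt ℝ (fderiv ℝ f) z :=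
    (hf.fderiv_right (m := 1) one_add_one_eq_two.le).differentiableAt one_ne_zero
  have second (α β) : pd α (pd β f) z
      = fderiv ℝ (fderiv ℝ f) z (Pi.single α 1) (Pi.single β 1) := by
    unfold pd
    rw [(hd.hasFDerivAt.clm_apply (hasFDerivAt_const (Pi.single β 1 : κ' → ℝ) z)).fderiv]
    simp
  rw [second, second, hf.isSymmSndFDerivAt (by simp)]

variable [Fintype κ]

lemma differentiableAt_vecMul_jacobian_add {a : (κ → ℝ) → κ → ℝ} {φ : (κ' → ℝ) → κ → ℝ}
    {s : (κ' → ℝ) → ℝ} {y : κ' → ℝ} (ha : ∀ γ, DifferentiableAt ℝ (fun w => a w γ) (φ y))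
    (hφ : ContDiffAt ℝ 2 φ y) (hs : ContDiffAt ℝ 2 s y) (β : κ') :
    DifferentiableAt ℝ (fun w => (a (φ w) ᵥ* jacobian φ w) β + pd β s w) y := by
  have haφ (γ) : DifferentiableAt ℝ (fun w => a (φ w) γ) y :=
    DifferentiableAt.comp y (g := fun w => a w γ) (ha γ) (hφ.differentiableAt two_ne_zero)
  have hJ (γ) : DifferentiableAt ℝ (fun w => jacobian φ w γ β) y :=
    (contDiffAt_pd (r := 1) (contDiffAt_pi.1 hφ γ) one_add_one_eq_two.le β).differentiableAt
      one_ne_zero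
  exact (DifferentiableAt.fun_sum (u := Finset.univ) fun γ _ => (haφ γ).mul (hJ γ)).add
    ((contDiffAt_pd (r := 1) hs one_add_one_eq_two.le β).differentiableAt one_ne_zero)

variable [DecidableEq κ]

/-- `d (φ^* a + ds) = φ^* (da)`. -/
lemma curvature_vecMul_jacobian_add {a : (κ → ℝ) → κ → ℝ} {φ : (κ' → ℝ) → κ → ℝ}
    {s : (κ' → ℝ) → ℝ} {y : κ' → ℝ} (ha : ∀ γ, DifferentiableAt ℝ (fun w => a w γ) (φ y))
    (hφ : ContDiffAt ℝ 2 φ y) (hs : ContDiffAt ℝ 2 s y) :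
    curvature (fun w β => (a (φ w) ᵥ* jacobian φ w) β + pd β s w) y
      = (jacobian φ y)ᵀ * curvature a (φ y) * jacobian φ y := by
  have hφd := hφ.differentiableAt two_ne_zero
  have hφ' (γ) : ContDiffAt ℝ 2 (fun w => φ w γ) y := contDiffAt_pi.1 hφ γ
  have hJ (γ α) : DifferentiableAt ℝ (fun w => jacobian φ w γ α) y :=
    (contDiffAt_pd (r := 1) (hφ' γ) one_add_one_eq_two.le α).differentiableAt one_ne_zero
  have hds (α) : DifferentiableAt ℝ (pd α s) y :=
    (contDiffAt_pd (r := 1) hs one_add_one_eq_two.le α).differentiableAt one_ne_zero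
  have haφ (γ) : DifferentiableAt ℝ (fun w => a (φ w) γ) y :=
    DifferentiableAt.comp y (g := fun w => a w γ) (ha γ) hφd
  have expand (α β) : pd α (fun w => (a (φ w) ᵥ* jacobian φ w) β + pd β s w) y
      = (∑ γ, ∑ δ, jacobian φ y δ α * pd δ (fun w => a w γ) (φ y) * jacobian φ y γ β)
        + (∑ γ, a (φ y) γ * pd α (pd β fun w => φ w γ) y + pd α (pd β s) y) := by
    have hterm (γ) : DifferentiableAt ℝ (fun w => a (φ w) γ * jacobian φ w γ β) y :=
      (haφ γ).mul (hJ γ β)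
    simp only [vecMul, dotProduct]
    rw [pd_add α (DifferentiableAt.fun_sum fun γ _ => hterm γ) (hds β),
      pd_sum α fun γ _ => hterm γ, ← add_assoc, ← Finset.sum_add_distrib]
    congr 1
    refine Finset.sum_congr rfl fun γ _ => ?_
    rw [pd_mul α (haφ γ) (hJ γ β), pd_comp (f := fun w => a w γ) (ha γ) hφd, Finset.sum_mul]
    congr 1
    exact Finset.sum_congr rfl fun δ _ => by ring
  ext α β
  simp only [curvature, of_apply, expand, fun γ => pd_comm (hφ' γ) β α, pd_comm hs β α,
    add_sub_add_right_eq_sub, mul_apply, transpose_apply, mul_sub, sub_mul, Finset.sum_mul,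
    Finset.sum_sub_distrib]
  congr 1
  rw [Finset.sum_comm]
  exact Finset.sum_congr rfl fun γ _ => Finset.sum_congr rfl fun δ _ => by ring

end Jacobian

section BlockTriangular

open Matrix

variable {μ ν : Type*} [Fintype μ] [DecidableEq μ] [Fintype ν] [DecidableEq ν]

lemma transpose_mul_kkMatrix_mul (g Φ : Matrix μ μ ℝ) (A S : Matrix ν μ ℝ) (G : Matrix ν ν ℝ)
    {L : Matrix ν ν ℝ} (hL : L.det ≠ 0) :
    (fromBlocks Φ 0 S L)ᵀ * kkMatrix g A G * fromBlocks Φ 0 S L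
      = kkMatrix (Φᵀ * g * Φ) (L⁻¹ * (A * Φ + S)) (Lᵀ * G * L) := by
  have hLA : L * (L⁻¹ * (A * Φ + S)) = A * Φ + S := mul_nonsing_inv_cancel_left _ _ hL.isUnit
  have hcoframe : coframe A * fromBlocks Φ 0 S L
      = fromBlocks Φ 0 0 L * coframe (L⁻¹ * (A * Φ + S)) := by
    simp [coframe, fromBlocks_multiply, hLA]
  have hblocks : fromBlocks (Φᵀ * g * Φ) 0 0 (Lᵀ * G * L)
      = (fromBlocks Φ 0 0 L)ᵀ * fromBlocks g 0 0 G * fromBlocks Φ 0 0 L := by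
    simp [fromBlocks_transpose, fromBlocks_multiply]
  calc _ = (coframe A * fromBlocks Φ 0 S L)ᵀ * fromBlocks g 0 0 G
        * (coframe A * fromBlocks Φ 0 S L) := by
        simp only [kkMatrix, transpose_mul, Matrix.mul_assoc]
    _ = _ := by
      rw [hcoframe, kkMatrix, hblocks]
      simp only [transpose_mul, Matrix.mul_assoc]

lemma kkMatrix_injective {g g' : Matrix μ μ ℝ} {A A' : Matrix ν μ ℝ} {G G' : Matrix ν ν ℝ}
    (hG : G.det ≠ 0) (h : kkMatrix g A G = kkMatrix g' A' G') : g = g' ∧ A = A' ∧ G = G' := by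
  rw [kkMatrix_eq_fromBlocks, kkMatrix_eq_fromBlocks] at h
  obtain ⟨h₁₁, -, h₂₁, rfl⟩ := fromBlocks_inj.1 h
  obtain rfl : A = A' := by
    rw [← nonsing_inv_mul_cancel_left G A hG.isUnit, h₂₁,
      nonsing_inv_mul_cancel_left G A' hG.isUnit]
  exact ⟨add_right_cancel h₁₁, rfl, rfl⟩

end BlockTriangular

section TwistChange

open Matrix

variable {ν : Type*} [Fintype ν]

lemma curvature_mul_jacobian_add {A A' : (Fin 2 → ℝ) → Matrix ν (Fin 2) ℝ}
    {φ : (Fin 2 → ℝ) → Fin 2 → ℝ} {s : (Fin 2 → ℝ) → ν → ℝ} {X : Matrix ν ν ℝ} {y : Fin 2 → ℝ}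
    (hA : ∀ K γ, DifferentiableAt ℝ (fun w => A w K γ) (φ y)) (hφ : ContDiffAt ℝ 2 φ y)
    (hs : ContDiffAt ℝ 2 s y)
    (h : A' =ᶠ[𝓝 y] fun w => X * (A (φ w) * jacobian φ w + jacobian s w)) :
    (fun J => curvature (fun w => A' w J) y 0 1)
      = (jacobian φ y).det • (X *ᵥ fun K => curvature (fun w => A w K) (φ y) 0 1) := by
  let a (K : ν) (w : Fin 2 → ℝ) (β : Fin 2) : ℝ :=
    (A (φ w) K ᵥ* jacobian φ w) β + pd β (fun w => s w K) w
  have hs' (K) : ContDiffAt ℝ 2 (fun w => s w K) y := contDiffAt_pi.1 hs K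
  have gauge (K) : curvature (a K) y 0 1
      = (jacobian φ y).det * curvature (fun w => A w K) (φ y) 0 1 := by
    have area := mul_areaMatrix_mul_transpose (jacobian φ y)ᵀ
    rw [transpose_transpose, det_transpose] at area
    rw [curvature_vecMul_jacobian_add (hA K) hφ (hs' K), curvature_fin_two _ (φ y),
      Matrix.mul_smul, Matrix.smul_mul, area]
    simp [areaMatrix, mul_comm]
  have ha (K β) : DifferentiableAt ℝ (fun w => a K w β) y :=
    differentiableAt_vecMul_jacobian_add (hA K) hφ (hs' K) β
  funext J
  have congr_curvature : curvature (fun w => A' w J) y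
      = curvature (fun w β => ∑ K, X J K * a K w β) y := by
    ext α β
    have entry (α β) : pd α (fun w => A' w J β) y = pd α (fun w => ∑ K, X J K * a K w β) y :=
      pd_congr (h.mono fun w hw => by rw [hw]; rfl) α
    simp only [curvature, of_apply, entry]
  rw [congr_curvature, curvature_sum_smul ha]
  simp [gauge, Matrix.sum_apply, mulVec, dotProduct, Finset.mul_sum, mul_left_comm]

variable [DecidableEq ν]

lemma kkTwist_eq_smul_mulVec (g : (Fin 2 → ℝ) → Matrix (Fin 2) (Fin 2) ℝ)
    (A : (Fin 2 → ℝ) → Matrix ν (Fin 2) ℝ) (G : (Fin 2 → ℝ) → Matrix ν ν ℝ) (y : Fin 2 → ℝ) :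
    (fun I => kkTwist g A G I y) = (√(G y).det / √(g y).det) •
      (G y *ᵥ fun J => curvature (fun w => A w J) y 0 1) := by
  funext I
  simp only [kkTwist, Pi.smul_apply, smul_eq_mul, mulVec, dotProduct, Finset.mul_sum]
  exact Finset.sum_congr rfl fun J _ => by ring

lemma sqrt_det_transpose_mul_mul (X Y : Matrix ν ν ℝ) : √(Xᵀ * Y * X).det = |X.det| * √Y.det := by
  rw [det_mul, det_mul, det_transpose, mul_right_comm, ← sq, Real.sqrt_mul (sq_nonneg _),
    Real.sqrt_sq_eq_abs]

/-- Orientation-preserving coordinate changes leave the area form invariant, so the twist transforms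
like a section of the dual bundle. -/
theorem kkTwist_coordinate_change {g g' : (Fin 2 → ℝ) → Matrix (Fin 2) (Fin 2) ℝ}
    {A A' : (Fin 2 → ℝ) → Matrix ν (Fin 2) ℝ} {G G' : (Fin 2 → ℝ) → Matrix ν ν ℝ}
    {φ : (Fin 2 → ℝ) → Fin 2 → ℝ} {s : (Fin 2 → ℝ) → ν → ℝ} {L : Matrix ν ν ℝ} {y : Fin 2 → ℝ}
    (hA : ∀ K γ, DifferentiableAt ℝ (fun w => A w K γ) (φ y))
    (hG' : ∀ᶠ w in 𝓝 y, (G' w).det ≠ 0) (hφ : ContDiffAt ℝ 2 φ y) (hs : ContDiffAt ℝ 2 s y)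
    (hL : |L.det| = 1)
    (h : ∀ᶠ w in 𝓝 y, kkMatrix (g' w) (A' w) (G' w)
      = (fromBlocks (jacobian φ w) 0 (jacobian s w) L)ᵀ
        * kkMatrix (g (φ w)) (A (φ w)) (G (φ w))
        * fromBlocks (jacobian φ w) 0 (jacobian s w) L) :
    (fun I => kkTwist g' A' G' I y) = ((jacobian φ y).det / |(jacobian φ y).det|) •
      (Lᵀ *ᵥ fun K => kkTwist g A G K (φ y)) := by
  have hL_ne : L.det ≠ 0 := fun h => by simp [h] at hL
  have components : ∀ᶠ w in 𝓝 y, g' w = (jacobian φ w)ᵀ * g (φ w) * jacobian φ w ∧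
      A' w = L⁻¹ * (A (φ w) * jacobian φ w + jacobian s w) ∧ G' w = Lᵀ * G (φ w) * L := by
    filter_upwards [hG', h] with w hGw hw
    rw [transpose_mul_kkMatrix_mul _ _ _ _ _ hL_ne] at hw
    exact kkMatrix_injective hGw hw
  have curvature_change := curvature_mul_jacobian_add hA hφ hs (components.mono fun _ hw => hw.2.1)
  obtain ⟨hg, -, hG⟩ := components.self_of_nhds
  rw [kkTwist_eq_smul_mulVec, kkTwist_eq_smul_mulVec, curvature_change, hg, hG,
    sqrt_det_transpose_mul_mul, sqrt_det_transpose_mul_mul, hL, mulVec_smul, mulVec_smul,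
    mulVec_mulVec, mulVec_mulVec, mul_nonsing_inv_cancel_right _ _ hL_ne.isUnit, smul_smul,
    smul_smul]
  congr 1
  ring

end TwistChange

/-! ### Changes of adapted coordinates -/

section EuclideanMatrix

open Matrix

variable {κ : Type*} [Fintype κ] [DecidableEq κ]

lemma det_toEuclideanCLM_symm (T : EuclideanSpace ℝ κ →L[ℝ] EuclideanSpace ℝ κ) :
    ((toEuclideanCLM (𝕜 := ℝ)).symm T).det = T.det := by
  obtain ⟨X, rfl⟩ := EquivLike.surjective (toEuclideanCLM (n := κ) (𝕜 := ℝ)) T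
  rw [StarAlgEquiv.symm_apply_apply, ContinuousLinearMap.det, coe_toEuclideanCLM_eq_toEuclideanLin,
    toEuclideanLin, toLpLin_eq_toLin, LinearMap.det_toLin]

lemma toEuclideanCLM_symm_mulVec (T : EuclideanSpace ℝ κ →L[ℝ] EuclideanSpace ℝ κ)
    (v : EuclideanSpace ℝ κ) :
    (toEuclideanCLM (𝕜 := ℝ)).symm T *ᵥ WithLp.ofLp v = WithLp.ofLp (T v) := by
  rw [← ofLp_toEuclideanCLM, StarAlgEquiv.apply_symm_apply]

lemma jacobian_ofLp_comp_toLp {F : EuclideanSpace ℝ κ → EuclideanSpace ℝ κ} {y : κ → ℝ}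
    (hF : DifferentiableAt ℝ F (WithLp.toLp 2 y)) :
    jacobian (fun w => WithLp.ofLp (F (WithLp.toLp 2 w))) y
      = (toEuclideanCLM (𝕜 := ℝ)).symm (fderiv ℝ F (WithLp.toLp 2 y)) := by
  have hderiv := (EuclideanSpace.equiv κ ℝ).hasFDerivAt.comp y
    (hF.hasFDerivAt.comp y (EuclideanSpace.equiv κ ℝ).symm.hasFDerivAt)
  refine ext_of_mulVec_single fun k => ?_
  have h := DFunLike.congr_fun
    ((hasFDerivAt_jacobian hderiv.differentiableAt).unique hderiv) (Pi.single k 1)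
  exact h.trans (toEuclideanCLM_symm_mulVec _ (WithLp.toLp 2 (Pi.single k 1))).symm

end EuclideanMatrix

section AffineChange

open Matrix

variable {μ μ' ν ν' : Type*} [Fintype ν']

/-- The coordinate change `(y, x) ↦ (φ y, L x + s y)`, which acts by affine maps on the fibers. -/
noncomputable def affineChange (φ : (μ' → ℝ) → μ → ℝ) (s : (μ' → ℝ) → ν → ℝ) (L : Matrix ν ν' ℝ)
    (z : μ' ⊕ ν' → ℝ) : μ ⊕ ν → ℝ :=
  Sum.elim (φ (baseCoord μ' ν' z)) (L *ᵥ WithLp.ofLp (fiberCoord μ' ν' z) + s (baseCoord μ' ν' z))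

lemma hasFDerivAt_affineChange [Fintype μ'] [DecidableEq μ'] [DecidableEq ν'] [Finite μ] [Finite ν]
    {φ : (μ' → ℝ) → μ → ℝ} {s : (μ' → ℝ) → ν → ℝ} (L : Matrix ν ν' ℝ) {z : μ' ⊕ ν' → ℝ}
    (hφ : DifferentiableAt ℝ φ (baseCoord μ' ν' z))
    (hs : DifferentiableAt ℝ s (baseCoord μ' ν' z)) :
    HasFDerivAt (affineChange φ s L) (Matrix.toLin' (fromBlocks (jacobian φ (baseCoord μ' ν' z)) 0
      (jacobian s (baseCoord μ' ν' z)) L)).toContinuousLinearMap z := by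
  cases nonempty_fintype μ
  cases nonempty_fintype ν
  have hbase := (baseCoord μ' ν').hasFDerivAt (x := z)
  have dφ := (hasFDerivAt_jacobian hφ).comp z hbase
  have ds := (hasFDerivAt_jacobian hs).comp z hbase
  have dL := ((Matrix.toLin' L).toContinuousLinearMap ∘L
    (EuclideanSpace.equiv ν' ℝ).toContinuousLinearMap ∘L fiberCoord μ' ν').hasFDerivAt (x := z)
  refine hasFDerivAt_pi'.2 ?_
  rintro (γ | I)
  · refine (hasFDerivAt_pi'.1 dφ γ).congr_fderiv (ContinuousLinearMap.ext fun v => ?_)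
    simp [fromBlocks_mulVec]
    rfl
  · refine (hasFDerivAt_pi'.1 (dL.add ds) I).congr_fderiv (ContinuousLinearMap.ext fun v => ?_)
    change (L *ᵥ (v ∘ Sum.inr)) I + (jacobian s _ *ᵥ (v ∘ Sum.inl)) I = (fromBlocks _ _ _ _ *ᵥ v) _
    rw [fromBlocks_mulVec]
    exact add_comm _ _

end AffineChange

namespace TwistedBundle

section LinAut

variable {ι : Type*} {n N : ℕ} {B 𝒢 M : Type*}
  [TopologicalSpace B] [ChartedSpace (EuclideanSpace ℝ (Fin n)) B] [IsManifold (𝓡 n) ∞ B]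
  [AddCommGroup 𝒢] [TopologicalSpace 𝒢] [ChartedSpace (EuclideanSpace ℝ (Fin N)) 𝒢]
  [TopologicalSpace M] [ChartedSpace (EuclideanSpace ℝ (Fin (n + N))) M]
  {P : TwistedBundle ι n N B 𝒢 M}

/-- The matrix of the transition function `linAut i j b` of `e` in the standard basis. -/
noncomputable def linAutMatrix (P : TwistedBundle ι n N B 𝒢 M) (i j : ι) (b : B) :
    Matrix (Fin N) (Fin N) ℝ :=
  (Matrix.toEuclideanCLM (𝕜 := ℝ)).symm (P.linAut i j b)

namespace AdaptedCoords

lemma aut_lin [LieAddGroup (𝓡 N) ∞ 𝒢] (C C' : P.AdaptedCoords) {i j : ι} {b : B}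
    (hb : b ∈ (P.triv i).baseSet ∩ (P.triv j).baseSet) (v : EuclideanSpace ℝ (Fin N)) :
    P.aut i j b (C'.lin v) = C.lin (P.linAut i j b v) := by
  have haut : HasMFDerivAt (𝓡 N) (𝓡 N) (P.aut i j b) (C'.lin 0) (P.linAut i j b) := by
    rw [map_zero]
    exact ((P.contMDiff_aut i j b hb).1.mdifferentiableAt (by simp)).hasMFDerivAt
  have hlin : HasMFDerivAt (𝓡 N) (𝓡 N) C.lin (P.linAut i j b 0)
      (ContinuousLinearMap.id ℝ (EuclideanSpace ℝ (Fin N))) := by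
    rw [map_zero]
    exact C.hasMFDerivAt_lin_zero
  have left := haut.comp 0 C'.hasMFDerivAt_lin_zero
  have right := hlin.comp 0 (P.linAut i j b).hasMFDerivAt
  exact DFunLike.congr_fun (addMonoidHom_eq_of_hasMFDerivAt
    (p := (P.aut i j b).toAddMonoidHom.comp C'.lin)
    (q := C.lin.comp (P.linAut i j b).toLinearMap.toAddMonoidHom)
    (f' := P.linAut i j b) left right) v

/-- The change of the base coordinates, from those of `C'` to those of `C`. -/
noncomputable def baseChange (C C' : P.AdaptedCoords) (y : Fin n → ℝ) : Fin n → ℝ :=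
  WithLp.ofLp (C.chart (C'.point y))

variable {C C' : P.AdaptedCoords} {y : Fin n → ℝ}

lemma point_baseChange (h : C'.point y ∈ C.chart.source) :
    C.point (baseChange C C' y) = C'.point y :=
  C.chart.left_inv h

lemma baseChange_mem_domain (h : C'.point y ∈ C.chart.source)
    (h' : C'.point y ∈ (P.triv C.idx).baseSet) : baseChange C C' y ∈ C.domain :=
  ⟨C.chart.map_source h, by rwa [point_baseChange h]⟩

lemma contDiffAt_baseChange (hy : y ∈ C'.domain) (h : C'.point y ∈ C.chart.source) :
    ContDiffAt ℝ ∞ (baseChange C C') y :=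
  ((PiLp.contDiff_ofLp (p := 2)).contMDiff.contMDiffAt.comp y
    ((contMDiffAt_of_mem_maximalAtlas C.chart_mem h).comp y (contMDiffAt_point hy))).contDiffAt

lemma exists_lin_eq_shift_sub [LieAddGroup (𝓡 N) ∞ 𝒢] (hy : y ∈ C'.domain)
    (h' : C'.point y ∈ (P.triv C.idx).baseSet) :
    ∃ s : (Fin n → ℝ) → EuclideanSpace ℝ (Fin N), ContDiffAt ℝ ∞ s y ∧ ∀ᶠ w in 𝓝 y,
      C.lin (s w) = P.shift C.idx C'.idx (C'.point w) - P.shift C.idx C'.idx (C'.point y) := by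
  have hopen := (P.triv C.idx).open_baseSet.inter (P.triv C'.idx).open_baseSet
  have hshift : ContMDiffAt 𝓘(ℝ, Fin n → ℝ) (𝓡 N) ∞ (fun w =>
      P.shift C.idx C'.idx (C'.point w) - P.shift C.idx C'.idx (C'.point y)) y :=
    (((P.contMDiffOn_shift C.idx C'.idx).contMDiffAt (hopen.mem_nhds ⟨h', hy.2⟩)).comp y
      (contMDiffAt_point hy)).sub contMDiffAt_const
  obtain ⟨l, hl, -, -, hl_right⟩ := C.exists_lin_inverse 0
  rw [map_zero, ← sub_self (P.shift C.idx C'.idx (C'.point y))] at hl hl_right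
  exact ⟨_, (ContMDiffAt.comp y (g := l) hl hshift).contDiffAt,
    hshift.continuousAt.tendsto.eventually hl_right⟩

section Change

variable [LieAddGroup (𝓡 N) ∞ 𝒢] (hy : y ∈ C'.domain) (h : C'.point y ∈ C.chart.source)
  (h' : C'.point y ∈ (P.triv C.idx).baseSet)
include hy h h'

/-- As `lin` is only a local diffeomorphism, the shift between the trivializations has linear
coordinates `s` only up to a constant `c`. -/
lemma exists_param_change : ∃ (s : (Fin n → ℝ) → Fin N → ℝ) (c : 𝒢), ContDiffAt ℝ ∞ s y ∧
    ∀ᶠ w in 𝓝 y, ∀ z, baseCoord (Fin n) (Fin N) z = w →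
      C'.param z = P.act C.idx c (C.param (affineChange (baseChange C C') s
        (P.linAutMatrix C.idx C'.idx (C'.point y)) z)) := by
  have hopen := (P.triv C.idx).open_baseSet.inter (P.triv C'.idx).open_baseSet
  have hpoint := (contMDiffAt_point hy).continuousAt
  obtain ⟨s, hs, lin_s⟩ := exists_lin_eq_shift_sub hy h'
  refine ⟨fun w => WithLp.ofLp (s w), P.shift C.idx C'.idx (C'.point y),
    (PiLp.contDiff_ofLp (p := 2)).contDiffAt.comp y hs, ?_⟩
  filter_upwards [lin_s, hpoint.eventually_mem (hopen.mem_nhds ⟨h', hy.2⟩),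
    hpoint.eventually (P.aut_locallyConstant _ _ _ ⟨h', hy.2⟩),
    hpoint.eventually_mem (C.chart.open_source.mem_nhds h)] with w lin_sw hw haut hsource z hz
  have fiber : fiberCoord (Fin n) (Fin N) (affineChange (baseChange C C')
      (fun w => WithLp.ofLp (s w)) (P.linAutMatrix C.idx C'.idx (C'.point y)) z)
      = P.linAut C.idx C'.idx (C'.point y) (fiberCoord (Fin n) (Fin N) z) + s w := by
    rw [affineChange, linAutMatrix, toEuclideanCLM_symm_mulVec, hz]
    rfl
  have base : C.point (baseCoord (Fin n) (Fin N) (affineChange (baseChange C C')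
      (fun w => WithLp.ofLp (s w)) (P.linAutMatrix C.idx C'.idx (C'.point y)) z))
      = C'.point w := by
    rw [← point_baseChange hsource, ← hz]
    rfl
  rw [C'.param_eq, C.param_eq, fiber, base, hz, act_triv_symm hw.1, P.transition _ _ _ hw, haut,
    map_add, lin_sw, aut_lin C C' ⟨h', hy.2⟩]
  congr 2
  abel

lemma exists_metric_change [IsManifold (𝓡 (n + N)) ∞ M] {gbar : SmoothMetric (n + N) M}
    (hinv : P.IsInvariant gbar) :
    ∃ s : (Fin n → ℝ) → Fin N → ℝ, ContDiffAt ℝ ∞ s y ∧ ∀ᶠ w in 𝓝 y, C'.metric gbar w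
      = (Matrix.fromBlocks (jacobian (baseChange C C') w) 0 (jacobian s w)
          (P.linAutMatrix C.idx C'.idx (C'.point y))).transpose
        * C.metric gbar (baseChange C C' w)
        * Matrix.fromBlocks (jacobian (baseChange C C') w) 0 (jacobian s w)
          (P.linAutMatrix C.idx C'.idx (C'.point y)) := by
  have hpoint := (contMDiffAt_point hy).continuousAt
  obtain ⟨s, c, hs, param_change⟩ := exists_param_change hy h h'
  have hs_eventually : ∀ᶠ w in 𝓝 y, ContDiffAt ℝ 1 s w :=
    (hs.of_le (m := 1) (WithTop.coe_le_coe.2 le_top)).eventually (by simp)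
  refine ⟨s, hs, ?_⟩
  filter_upwards [param_change.eventually_nhds, hs_eventually, C'.isOpen_domain.mem_nhds hy,
    hpoint.eventually_mem (C.chart.open_source.mem_nhds h),
    hpoint.eventually_mem ((P.triv C.idx).open_baseSet.mem_nhds h')]
    with w change hsw hw hsource hbase
  set z : Fin n ⊕ Fin N → ℝ := Sum.elim w 0
  set θ := affineChange (baseChange C C') s (P.linAutMatrix C.idx C'.idx (C'.point y))
  have hθ := hasFDerivAt_affineChange (z := z) (P.linAutMatrix C.idx C'.idx (C'.point y))
    ((contDiffAt_baseChange hw hsource).differentiableAt (by simp))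
    (hsw.differentiableAt one_ne_zero)
  have hθz : θ z ∈ C.paramDomain := baseChange_mem_domain hsource hbase
  have factor : C'.param =ᶠ[𝓝 z] P.act C.idx c ∘ C.param ∘ θ :=
    (((baseCoord (Fin n) (Fin N)).continuous.continuousAt (x := z)).eventually change).mono
      fun u hu => hu u rfl
  have pullback := coordMetric_eq_transpose_mul_mul (pullbackForm_comp factor hθ
    (mdifferentiableAt_param hθz) (mdifferentiableAt_act c (param_mem_source hθz))
    (hinv C.idx c _ (param_mem_source hθz)))
  rw [coordMetric_param_eq_metric hinv hθz, LinearMap.coe_toContinuousLinearMap,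
    LinearMap.toMatrix'_toLin'] at pullback
  exact pullback

lemma det_jacobian_baseChange_ne_zero [IsManifold (𝓡 (n + N)) ∞ M] {gbar : SmoothMetric (n + N) M}
    (hinv : P.IsInvariant gbar) : (jacobian (baseChange C C') y).det ≠ 0 := by
  obtain ⟨s, -, metric_change⟩ := exists_metric_change hy h h' hinv
  intro h0
  have hpos := (posDef_metric gbar hy).det_pos
  rw [metric_change.self_of_nhds, Matrix.det_mul, Matrix.det_mul, Matrix.det_fromBlocks_zero₁₂, h0,
    zero_mul, mul_zero] at hpos
  exact hpos.false

end Change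

lemma det_jacobian_baseChange_pos {o : OrientedAtlas n B} (hC : C.chart ∈ o.charts)
    (hC' : C'.chart ∈ o.charts) (hy : y ∈ C'.domain) (h : C'.point y ∈ C.chart.source) :
    0 < (jacobian (baseChange C C') y).det := by
  have hF : DifferentiableAt ℝ (C.chart ∘ C'.chart.symm) (WithLp.toLp 2 y) :=
    ((contMDiffAt_of_mem_maximalAtlas C.chart_mem h).comp (WithLp.toLp 2 y)
      (contMDiffAt_symm_of_mem_maximalAtlas C'.chart_mem hy.1)).contDiffAt.differentiableAt
        (by simp)
  have hJ : jacobian (baseChange C C') y = _ := jacobian_ofLp_comp_toLp hF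
  rw [hJ, det_toEuclideanCLM_symm]
  exact o.det_pos _ hC' _ hC (WithLp.toLp 2 y) ⟨hy.1, h⟩

end AdaptedCoords

end LinAut

section TwistChange

variable {ι : Type*} {N : ℕ} {B 𝒢 M : Type*}
  [TopologicalSpace B] [ChartedSpace (EuclideanSpace ℝ (Fin 2)) B] [IsManifold (𝓡 2) ∞ B]
  [AddCommGroup 𝒢] [TopologicalSpace 𝒢] [ChartedSpace (EuclideanSpace ℝ (Fin N)) 𝒢]
  [LieAddGroup (𝓡 N) ∞ 𝒢]
  [TopologicalSpace M] [ChartedSpace (EuclideanSpace ℝ (Fin (2 + N))) M]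
  [IsManifold (𝓡 (2 + N)) ∞ M] {P : TwistedBundle ι 2 N B 𝒢 M} {gbar : SmoothMetric (2 + N) M}

namespace AdaptedCoords

theorem twist_change (hdet : P.HasDetOne) (hinv : P.IsInvariant gbar) {C C' : P.AdaptedCoords}
    {y : Fin 2 → ℝ} (hy : y ∈ C'.domain) (h : C'.point y ∈ C.chart.source)
    (h' : C'.point y ∈ (P.triv C.idx).baseSet) :
    (fun I => C'.twist gbar I y) =
      ((jacobian (baseChange C C') y).det / |(jacobian (baseChange C C') y).det|) •
        Matrix.mulVec (P.linAutMatrix C.idx C'.idx (C'.point y)).transpose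
          (fun K => C.twist gbar K (baseChange C C' y)) := by
  have hpoint := (contMDiffAt_point hy).continuousAt
  have hdomain := C'.isOpen_domain.eventually_mem hy
  have hdet_aut : |(P.linAutMatrix C.idx C'.idx (C'.point y)).det| = 1 := by
    rw [linAutMatrix, det_toEuclideanCLM_symm]
    exact hdet _ _ _ ⟨h', hy.2⟩
  obtain ⟨s, hs, metric_change⟩ := exists_metric_change hy h h' hinv
  refine kkTwist_coordinate_change
    (fun I α => (contDiffAt_A gbar (baseChange_mem_domain h h') I α).differentiableAt (by simp))
    (hdomain.mono fun w hw => (posDef_G gbar hw).det_pos.ne')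
    ((contDiffAt_baseChange hy h).of_le ENat.LEInfty.out) (hs.of_le ENat.LEInfty.out) hdet_aut ?_
  filter_upwards [metric_change, hdomain,
    hpoint.eventually_mem (C.chart.open_source.mem_nhds h),
    hpoint.eventually_mem ((P.triv C.idx).open_baseSet.mem_nhds h')] with w change hw hsource hbase
  rwa [← metric_eq_kkMatrix gbar hw,
    ← metric_eq_kkMatrix gbar (baseChange_mem_domain hsource hbase)]

end AdaptedCoords

end TwistChange

end TwistedBundle

/-! ### Flat sections and monodromy -/

lemma eventually_div_abs_eq {X : Type*} [TopologicalSpace X] {f : X → ℝ} {x : X}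
    (hf : ContinuousAt f x) (h : f x ≠ 0) : ∀ᶠ w in 𝓝 x, f w / |f w| = f x / |f x| := by
  rcases h.lt_or_gt with h | h
  · filter_upwards [hf.eventually_lt_const h] with w hw
    rw [abs_of_neg h, abs_of_neg hw, div_neg_self hw.ne, div_neg_self h.ne]
  · filter_upwards [hf.eventually_const_lt h] with w hw
    rw [abs_of_pos h, abs_of_pos hw, div_self hw.ne', div_self h.ne']

namespace TwistedBundle

section FlatSection

variable {ι : Type*} {n N : ℕ} {B 𝒢 M : Type*}
  [TopologicalSpace B] [ChartedSpace (EuclideanSpace ℝ (Fin n)) B]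
  [AddCommGroup 𝒢] [TopologicalSpace 𝒢] [ChartedSpace (EuclideanSpace ℝ (Fin N)) 𝒢]
  [TopologicalSpace M] [ChartedSpace (EuclideanSpace ℝ (Fin (n + N))) M]

lemma linAut_self (P : TwistedBundle ι n N B 𝒢 M) {i : ι} {b : B} (hb : b ∈ (P.triv i).baseSet) :
    P.linAut i i b = ContinuousLinearMap.id ℝ _ := by
  have transition (x : 𝒢) : x = P.shift i i b + P.aut i i b x := by
    simpa only [(P.triv i).apply_symm_apply' hb] using
      congrArg (fun p => (P.triv i p).2) (P.transition i i b ⟨hb, hb⟩ x)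
  have shift_eq_zero : P.shift i i b = 0 := by simpa using (transition 0).symm
  have aut_eq_id : (P.aut i i b : 𝒢 → 𝒢) = id := funext fun x => by
    simpa [shift_eq_zero] using (transition x).symm
  rw [linAut, aut_eq_id]
  exact mfderiv_id

variable {P : TwistedBundle ι n N B 𝒢 M} {σ : ι → B → Module.Dual ℝ (EuclideanSpace ℝ (Fin N))}

lemma IsFlatSection.eq_zero [ConnectedSpace B] (hσ : P.IsFlatSection σ) {i j : ι} {b₀ b : B}
    (hb₀ : b₀ ∈ (P.triv i).baseSet) (h₀ : σ i b₀ = 0) (hb : b ∈ (P.triv j).baseSet) :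
    σ j b = 0 := by
  let zeros : Set B := {b | ∀ i, b ∈ (P.triv i).baseSet → σ i b = 0}
  have mem_zeros {i b} (hi : b ∈ (P.triv i).baseSet) : b ∈ zeros ↔ σ i b = 0 :=
    ⟨fun h => h i hi, fun h j hj => by rw [hσ.compatible i j b ⟨hi, hj⟩, h, LinearMap.zero_comp]⟩
  have locally_constant (b : B) : ∀ᶠ b' in 𝓝 b, (b' ∈ zeros ↔ b ∈ zeros) := by
    obtain ⟨i, hi⟩ := P.exists_mem_baseSet b
    filter_upwards [hσ.locallyConstant i b hi, (P.triv i).open_baseSet.mem_nhds hi] with b' h hb'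
    rw [mem_zeros hb', mem_zeros hi, h]
  have clopen : IsClopen zeros :=
    ⟨⟨isOpen_iff_mem_nhds.2 fun b hb => (locally_constant b).mono fun _ h h' => hb (h.1 h')⟩,
      isOpen_iff_mem_nhds.2 fun b hb => (locally_constant b).mono fun _ h => h.2 hb⟩
  exact (Set.eq_univ_iff_forall.1 (clopen.eq_univ ⟨b₀, (mem_zeros hb₀).2 h₀⟩) b) j hb

lemma IsFlatSection.hasTrivialLine (hσ : P.IsFlatSection σ) {i : ι} {b₀ : B} (h₀ : σ i b₀ ≠ 0) :
    P.HasTrivialLine i b₀ := by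
  refine ⟨ℝ ∙ σ i b₀, finrank_span_singleton h₀, fun γ v hv => ?_⟩
  obtain ⟨c, rfl⟩ := Submodule.mem_span_singleton.1 hv
  refine ⟨fun j t => c • σ j (γ t), ⟨fun j k t ht => ?_, fun j t ht => ?_⟩, by simp, by simp⟩
  · rw [hσ.compatible j k _ ht, LinearMap.smul_comp]
  · exact (γ.continuous.continuousAt.eventually (hσ.locallyConstant j _ ht)).mono
      fun s hs => congrArg (c • ·) hs

namespace AdaptedCoords

variable [IsManifold (𝓡 n) ∞ B] {C C' : P.AdaptedCoords}

lemma point_ofLp_chart {b : B} (h : b ∈ C.chart.source) :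
    C.point (WithLp.ofLp (C.chart b)) = b :=
  C.chart.left_inv h

lemma ofLp_chart_mem_domain {b : B} (h : b ∈ C.chart.source) (h' : b ∈ (P.triv C.idx).baseSet) :
    WithLp.ofLp (C.chart b) ∈ C.domain :=
  ⟨C.chart.map_source h, by rwa [point_ofLp_chart h]⟩

lemma exists_oriented_coords (o : OrientedAtlas n B) (C₀ : P.AdaptedCoords) {i : ι} {b : B}
    (hb : b ∈ (P.triv i).baseSet) : ∃ (C : P.AdaptedCoords) (y : Fin n → ℝ),
      C.idx = i ∧ C.chart ∈ o.charts ∧ y ∈ C.domain ∧ C.point y = b := by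
  obtain ⟨β, hβ, hbβ⟩ := o.exists_mem_source b
  let C : P.AdaptedCoords :=
    { C₀ with idx := i, chart := β, chart_mem := o.subset_maximalAtlas hβ }
  exact ⟨C, WithLp.ofLp (β b), rfl, hβ, ofLp_chart_mem_domain (C := C) hbβ hb,
    point_ofLp_chart (C := C) hbβ⟩

lemma continuousAt_det_jacobian_baseChange {y : Fin n → ℝ} (hy : y ∈ C'.domain)
    (h : C'.point y ∈ C.chart.source) :
    ContinuousAt (fun w => (jacobian (baseChange C C') w).det) y := by
  have hjacobian : ContinuousAt (jacobian (baseChange C C')) y :=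
    continuousAt_pi.2 fun γ => continuousAt_pi.2 fun α =>
      (contDiffAt_pd (contDiffAt_pi.1 (contDiffAt_baseChange hy h) γ)
        (r := 0) (by simp) α).continuousAt
  exact continuous_id.matrix_det.continuousAt.comp hjacobian

end AdaptedCoords

end FlatSection

section TwistForm

variable {ι : Type*} {N : ℕ} {B 𝒢 M : Type*}
  [TopologicalSpace B] [ChartedSpace (EuclideanSpace ℝ (Fin 2)) B] [IsManifold (𝓡 2) ∞ B]
  [AddCommGroup 𝒢] [TopologicalSpace 𝒢] [ChartedSpace (EuclideanSpace ℝ (Fin N)) 𝒢]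
  [TopologicalSpace M] [ChartedSpace (EuclideanSpace ℝ (Fin (2 + N))) M]
  [IsManifold (𝓡 (2 + N)) ∞ M] {P : TwistedBundle ι 2 N B 𝒢 M} {gbar : SmoothMetric (2 + N) M}

namespace AdaptedCoords

/-- The twist as an element of the fiber of `e*`, the dual of the Lie algebra `ℝ^N`. -/
noncomputable def twistForm (C : P.AdaptedCoords) (gbar : SmoothMetric (2 + N) M)
    (y : Fin 2 → ℝ) : Module.Dual ℝ (EuclideanSpace ℝ (Fin N)) :=
  (EuclideanSpace.basisFun (Fin N) ℝ).toBasis.constr ℝ fun I => C.twist gbar I y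

lemma twistForm_apply (C : P.AdaptedCoords) (y : Fin 2 → ℝ) (v : EuclideanSpace ℝ (Fin N)) :
    C.twistForm gbar y v = WithLp.ofLp v ⬝ᵥ fun I => C.twist gbar I y := by
  simp [twistForm, Module.Basis.constr_apply_fintype, dotProduct]

lemma twistForm_single (C : P.AdaptedCoords) (y : Fin 2 → ℝ) (I : Fin N) :
    C.twistForm gbar y (EuclideanSpace.single I 1) = C.twist gbar I y := by
  simp [twistForm_apply]

lemma eq_twistForm_iff {f : Module.Dual ℝ (EuclideanSpace ℝ (Fin N))} {C : P.AdaptedCoords}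
    {y : Fin 2 → ℝ} :
    f = C.twistForm gbar y ↔ ∀ I, f (EuclideanSpace.single I 1) = C.twist gbar I y := by
  refine ⟨fun h I => by rw [h, twistForm_single], fun h => ?_⟩
  exact (EuclideanSpace.basisFun (Fin N) ℝ).toBasis.ext fun I => by simpa [twistForm] using h I

end AdaptedCoords

open AdaptedCoords

variable [LieAddGroup (𝓡 N) ∞ 𝒢]

lemma AdaptedCoords.eventually_twistForm_eq (C : P.AdaptedCoords)
    (h : ∀ y ∈ C.domain, ∀ I k, pd k (C.twist gbar I) y = 0) {y : Fin 2 → ℝ} (hy : y ∈ C.domain) :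
    ∀ᶠ w in 𝓝 y, C.twistForm gbar w = C.twistForm gbar y := by
  obtain ⟨r, hr, hball⟩ := Metric.isOpen_iff.1 C.isOpen_domain y hy
  filter_upwards [Metric.ball_mem_nhds y hr] with w hw
  refine eq_twistForm_iff.2 fun I => ?_
  rw [twistForm_single]
  refine Metric.isOpen_ball.is_const_of_fderiv_eq_zero (convex_ball y r).isPreconnected
    (fun u hu => ((isKaluzaKleinAt gbar (hball hu)).differentiableAt_kkTwist
      I).differentiableWithinAt) (fun u hu => ?_) hw (Metric.mem_ball_self hr)
  ext v
  simp [fderiv_apply_eq_sum_pd, ← C.twist_eq_kkTwist, h u (hball hu)]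

lemma AdaptedCoords.F_eq_zero_of_twist {C : P.AdaptedCoords} {y : Fin 2 → ℝ} (hy : y ∈ C.domain)
    (h : ∀ I, C.twist gbar I y = 0) (I : Fin N) (α β : Fin 2) : C.F gbar I α β y = 0 := by
  have det_G_ne := (posDef_G gbar hy).det_pos
  have G_mulVec : (C.G gbar y).mulVec (fun J => C.F gbar J 0 1 y / √(C.g gbar y).det) = 0 :=
    funext fun K => (mul_eq_zero.1 (h K)).resolve_left (Real.sqrt_ne_zero'.2 det_G_ne)
  have F_zero_one : C.F gbar I 0 1 y = 0 :=
    (div_eq_zero_iff.1 (congrFun (Matrix.eq_zero_of_mulVec_eq_zero det_G_ne.ne' G_mulVec)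
      I)).resolve_right (Real.sqrt_ne_zero'.2 (det_g_pos gbar hy))
  rw [F, sub_eq_zero] at F_zero_one ⊢
  fin_cases α <;> fin_cases β <;> simp [F_zero_one]

variable (hdet : P.HasDetOne) (hinv : P.IsInvariant gbar)
include hdet hinv

section Change

variable {C C' : P.AdaptedCoords} {y : Fin 2 → ℝ} (hy : y ∈ C'.domain)
  (h : C'.point y ∈ C.chart.source) (h' : C'.point y ∈ (P.triv C.idx).baseSet)
include hy h h'

lemma AdaptedCoords.twistForm_change : C'.twistForm gbar y =
    ((jacobian (baseChange C C') y).det / |(jacobian (baseChange C C') y).det|) •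
      (C.twistForm gbar (baseChange C C' y) ∘ₗ
        (P.linAut C.idx C'.idx (C'.point y) : _ →ₗ[ℝ] _)) := by
  ext v
  rw [twistForm_apply, twist_change hdet hinv hy h h', dotProduct_smul,
    Matrix.dotProduct_mulVec, Matrix.vecMul_transpose, linAutMatrix, toEuclideanCLM_symm_mulVec]
  rw [LinearMap.smul_apply, LinearMap.comp_apply, twistForm_apply]
  rfl

end Change

lemma AdaptedCoords.twistForm_eq_comp_linAut {o : OrientedAtlas 2 B} {C C' : P.AdaptedCoords}
    (hC : C.chart ∈ o.charts) (hC' : C'.chart ∈ o.charts) {y y' : Fin 2 → ℝ} (hy : y ∈ C.domain)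
    (hy' : y' ∈ C'.domain) (hpoint : C'.point y' = C.point y) :
    C'.twistForm gbar y' = C.twistForm gbar y ∘ₗ
      (P.linAut C.idx C'.idx (C.point y) : _ →ₗ[ℝ] _) := by
  have hsource : C'.point y' ∈ C.chart.source := hpoint ▸ point_mem_source hy
  have hpos := det_jacobian_baseChange_pos hC hC' hy' hsource
  have hbaseChange : baseChange C C' y' = y := by rw [baseChange, hpoint, chart_point hy]
  rw [twistForm_change hdet hinv hy' hsource (hpoint ▸ hy.2), abs_of_pos hpos, div_self hpos.ne',
    one_smul, hbaseChange, hpoint]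

lemma exists_eq_twistForm (o : OrientedAtlas 2 B) (C₀ : P.AdaptedCoords) :
    ∃ σ : ι → B → Module.Dual ℝ (EuclideanSpace ℝ (Fin N)), ∀ C : P.AdaptedCoords,
      C.chart ∈ o.charts → ∀ y ∈ C.domain, σ C.idx (C.point y) = C.twistForm gbar y := by
  have : Nonempty P.AdaptedCoords := ⟨C₀⟩
  choose! D η idx_D chart_D mem_D point_D using fun i b (hb : b ∈ (P.triv i).baseSet) =>
    exists_oriented_coords o C₀ hb
  refine ⟨fun i b => (D i b).twistForm gbar (η i b), fun C hC y hy => ?_⟩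
  change (D C.idx (C.point y)).twistForm gbar (η C.idx (C.point y)) = _
  rw [twistForm_eq_comp_linAut hdet hinv hC (chart_D _ _ hy.2) hy (mem_D _ _ hy.2)
    (point_D _ _ hy.2), idx_D _ _ hy.2, linAut_self P hy.2]
  rfl

variable {o : OrientedAtlas 2 B} {σ : ι → B → Module.Dual ℝ (EuclideanSpace ℝ (Fin N))}

lemma isFlatSection_of_eq_twistForm (C₀ : P.AdaptedCoords)
    (hσ : ∀ C : P.AdaptedCoords, C.chart ∈ o.charts → ∀ y ∈ C.domain,
      σ C.idx (C.point y) = C.twistForm gbar y)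
    (hconst : ∀ C : P.AdaptedCoords, ∀ y ∈ C.domain, ∀ I k, pd k (C.twist gbar I) y = 0) :
    P.IsFlatSection σ where
  compatible i j b hb := by
    obtain ⟨C, y, rfl, hC, hy, rfl⟩ := exists_oriented_coords o C₀ hb.1
    obtain ⟨C', y', rfl, hC', hy', hpoint⟩ := exists_oriented_coords o C₀ hb.2
    rw [← hpoint, hσ C' hC' y' hy', hpoint, hσ C hC y hy,
      twistForm_eq_comp_linAut hdet hinv hC hC' hy hy' hpoint]
  locallyConstant i b hb := by
    obtain ⟨C, y, rfl, hC, hy, rfl⟩ := exists_oriented_coords o C₀ hb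
    have hcoord : ContinuousAt (fun b => WithLp.ofLp (C.chart b)) (C.point y) :=
      (PiLp.continuous_ofLp 2 _).continuousAt.comp (C.chart.continuousAt (point_mem_source hy))
    have hcoord_tendsto := hcoord.tendsto
    rw [chart_point hy] at hcoord_tendsto
    filter_upwards [hcoord_tendsto.eventually (C.eventually_twistForm_eq (hconst C) hy),
      C.chart.open_source.mem_nhds (point_mem_source hy),
      (P.triv C.idx).open_baseSet.mem_nhds hb] with b' htwist hsource hbase
    rw [hσ C hC y hy, ← htwist, ← hσ C hC _ (ofLp_chart_mem_domain hsource hbase),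
      point_ofLp_chart hsource]

theorem MixedRicciEquation.twistIsFlat (o : OrientedAtlas 2 B) (h : P.MixedRicciEquation gbar) :
    P.TwistIsFlat o gbar := by
  rcases isEmpty_or_nonempty P.AdaptedCoords with hempty | ⟨⟨C₀⟩⟩
  · exact ⟨0, ⟨fun _ _ _ _ => rfl, fun _ _ _ => Filter.Eventually.of_forall fun _ => rfl⟩,
      fun C => hempty.elim C⟩
  obtain ⟨σ, hσ⟩ := exists_eq_twistForm (gbar := gbar) hdet hinv o C₀
  exact ⟨σ, isFlatSection_of_eq_twistForm hdet hinv C₀ hσ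
    ((mixedRicciEquation_iff_pd_twist hinv).1 h),
    fun C hC y hy => eq_twistForm_iff.1 (hσ C hC y hy)⟩

/-- In arbitrary adapted coordinates the orientation enters the twist through the locally constant
sign of the Jacobian. -/
lemma exists_twistForm_eq_smul
    (hσ : ∀ C : P.AdaptedCoords, C.chart ∈ o.charts → ∀ y ∈ C.domain, ∀ I,
      σ C.idx (C.point y) (EuclideanSpace.single I 1) = C.twist gbar I y)
    (C : P.AdaptedCoords) {y : Fin 2 → ℝ} (hy : y ∈ C.domain) :
    ∃ ε : ℝ, ∀ᶠ w in 𝓝 y, C.twistForm gbar w = ε • σ C.idx (C.point w) := by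
  obtain ⟨C₁, y₁, hidx, hC₁, hy₁, hpoint⟩ := exists_oriented_coords o C hy.2
  have hsource : C.point y ∈ C₁.chart.source := hpoint ▸ point_mem_source hy₁
  have hsign := eventually_div_abs_eq (continuousAt_det_jacobian_baseChange hy hsource)
    (det_jacobian_baseChange_ne_zero hy hsource (hidx ▸ hy.2) hinv)
  refine ⟨(jacobian (baseChange C₁ C) y).det / |(jacobian (baseChange C₁ C) y).det|, ?_⟩
  filter_upwards [hsign, C.isOpen_domain.mem_nhds hy,
    (contMDiffAt_point hy).continuousAt.eventually_mem (C₁.chart.open_source.mem_nhds hsource)]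
    with w hsign_w hw hsource_w
  have hbase : C.point w ∈ (P.triv C₁.idx).baseSet := hidx ▸ hw.2
  have hσ₁ : σ C.idx (C.point w) = C₁.twistForm gbar (baseChange C₁ C w) := by
    rw [eq_twistForm_iff, ← hidx, ← point_baseChange hsource_w]
    exact hσ C₁ hC₁ _ (baseChange_mem_domain hsource_w hbase)
  rw [twistForm_change hdet hinv hw hsource_w hbase, hsign_w, hidx, linAut_self P hw.2, hσ₁]
  rfl

theorem TwistIsFlat.mixedRicciEquation (h : P.TwistIsFlat o gbar) : P.MixedRicciEquation gbar := by
  obtain ⟨σ, hflat, hσ⟩ := h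
  rw [mixedRicciEquation_iff_pd_twist hinv]
  intro C y hy I k
  obtain ⟨ε, hε⟩ := exists_twistForm_eq_smul hdet hinv hσ C hy
  have hconst : C.twist gbar I =ᶠ[𝓝 y]
      fun _ => ε * σ C.idx (C.point y) (EuclideanSpace.single I 1) := by
    filter_upwards [hε, (contMDiffAt_point hy).continuousAt.eventually
      (hflat.locallyConstant _ _ hy.2)] with w htwist hσw
    rw [← twistForm_single, htwist, hσw]
    rfl
  rw [pd_congr hconst, pd_const]

end TwistForm

end TwistedBundle

theorem corollary2p16 {ι : Type*} {N : ℕ} (hN : 1 ≤ N) {B 𝒢 M : Type*}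
    [TopologicalSpace B] [T2Space B] [SecondCountableTopology B] [ConnectedSpace B]
    [ChartedSpace (EuclideanSpace ℝ (Fin 2)) B] [IsManifold (𝓡 2) ∞ B]
    [AddCommGroup 𝒢] [TopologicalSpace 𝒢] [T2Space 𝒢] [ConnectedSpace 𝒢]
    [ChartedSpace (EuclideanSpace ℝ (Fin N)) 𝒢] [LieAddGroup (𝓡 N) ∞ 𝒢]
    [TopologicalSpace M] [ChartedSpace (EuclideanSpace ℝ (Fin (2 + N))) M]
    [IsManifold (𝓡 (2 + N)) ∞ M]
    (P : TwistedBundle ι 2 N B 𝒢 M) (hdet : P.HasDetOne) (o : OrientedAtlas 2 B)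
    (gbar : SmoothMetric (2 + N) M) (hinv : P.IsInvariant gbar) :
    (P.MixedRicciEquation gbar ↔ P.TwistIsFlat o gbar) ∧
    ∀ lam : ℝ, IsEinstein gbar lam →
      P.MixedRicciEquation gbar ∧
      ∀ (b₀ : B) (i : ι), b₀ ∈ (P.triv i).baseSet →
        ¬ P.HasTrivialLine i b₀ → P.CurvatureVanishes gbar := by
  refine ⟨⟨fun h => h.twistIsFlat hdet hinv o, fun h => h.mixedRicciEquation hdet hinv⟩,
    fun lam hE => ?_⟩
  have hmixed := TwistedBundle.mixedRicciEquation_of_isEinstein hE hinv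
  refine ⟨hmixed, fun b₀ i hb₀ hline C y hy => ?_⟩
  obtain ⟨σ, hflat, hσ⟩ := hmixed.twistIsFlat hdet hinv o
  have h₀ : σ i b₀ = 0 := by_contra fun h => hline (hflat.hasTrivialLine h)
  obtain ⟨ε, hε⟩ := TwistedBundle.exists_twistForm_eq_smul hdet hinv hσ C hy
  have htwist : C.twistForm gbar y = 0 := by
    rw [hε.self_of_nhds, hflat.eq_zero hb₀ h₀ hy.2, smul_zero]
  refine TwistedBundle.AdaptedCoords.F_eq_zero_of_twist hy fun I => ?_
  rw [← C.twistForm_single, htwist, LinearMap.zero_apply]
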